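/- All groups are finite. Let $C$ be a finite abelian group. For a group $\Gamma$, a $C$-fibred $\Gamma$-set is a finite $(\Gamma\times C)$-set on which $C$ acts freely, and $B_C^1(\Gamma)$ is the subgroup of the Burnside group $B(\Gamma\times C)$ generated by the classes of $C$-fibred $\Gamma$-sets. For $D\le\Gamma$ and a homomorphism $\delta:D\to C$ put $D_\delta=\{(a,\delta(a)^{-1}) : a\in D\}$, and let $C_\delta\Gamma/D$ be the $C$-fibred $\Gamma$-set $(\Gamma\times C)/D_\delta$. For a field $k$ write $kB_C^1(\Gamma)=k\otimes_{\mathbb Z}B_C^1(\Gamma)$. Composition $\circ: kB_C^1(G\times H)\times kB_C^1(H\times K)\to kB_C^1(G\times K)$ is the $k$-bilinear map that sends fibred sets $T,Y$ to the set of those orbits of $T\times Y$ under the action $(h,c)(t,y)=((h,c)t,(h,c^{-1})y)$ of $H\times C$ on which $C$ acts freely. Let $\mathcal P$ be the $k$-linear category whose objects are the finite groups, with $\mathrm{Hom}_{\mathcal P}(G,H)=kB_C^1(H\times G)$ and composition $\circ$; the identity of $G$ is the class of $(G\times G\times C)/\{(g,g,1):g\in G\}$. A $kB_C^1$-module (fibred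 biset functor) is a $k$-linear functor from $\mathcal P$ to $k$-vector spaces. A group $G$ is a minimal group of such a functor $S$ if $S(G)\ne0$ and $S(K)=0$ for every group $K$ with $|K|<|G|$. Let $I(G)\subseteq kB_C^1(G\times G)$ be the $k$-subspace spanned by all $\alpha\circ\beta$ with $\alpha\in kB_C^1(G\times K)$, $\beta\in kB_C^1(K\times G)$ and $|K|<|G|$; it is a two-sided ideal, and $\widehat{kB_C^1}(G)=kB_C^1(G\times G)/I(G)$. Let $k$ be any field, $C=\langle c\rangle$ cyclic of order $4$, $$G=Q_8=\langle x,y\mid x^4=1,\ yxy^{-1}=x^{-1},\ x^2=y^2\rangle,\qquad H=D_8=\langle a,b\mid a^4=b^2=1,\ bab^{-1}=a^{-1}\rangle$$ (the dihedral group of order $8$), and $D=\langle (x,a),(y,b)\rangle\le G\times H$. Then: 1. There is a unique homomorphism $\delta:D\to C$ with $\delta(x,a)=c^2$ and $\delta(y,b)=c^{-1}$. 2. Let $X=C_\delta(G\times H)/D$ and $X^o=C_{\delta^o}(H\times G)/D^o$, where $D^o=\{(h,g):(g,h)\in D\}$ and $\delta^o(h,g)=\delta(g,h)^{-1}$. Then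 $W=X\circ X^o$ is an idempotent of $kB_C^1(G\times G)$, and its class in $\widehat{kB_C^1}(G)$ is nonzero. 3. The groups $Q_8$ and $D_8$ are not isomorphic, and there is a simple $kB_C^1$-module for which both $Q_8$ and $D_8$ are minimal groups. 4. Consequently the following conjectural parametrization of the simple $kB_C^1$-modules (the case of $kB_C^1$ of a conjecture on modules over Green biset functors) is false. Consider couples $(K,V)$, where $K$ is a finite group with $\widehat{kB_C^1}(K)\neq0$ and $V$ is a simple $\widehat{kB_C^1}(K)$-module; two couples $(K,V)$ and $(L,V')$ are equivalent if there is an isomorphism $K\cong L$ along which $V$ and $V'$ become isomorphic modules. The parametrization asserts that there is a bijection from the set of isomorphism classes of simple $kB_C^1$-modules to the set of equivalence classes of couples that sends the class of $S$ to the class of $(K,S(K))$ for every minimal group $K$ of $S$. -/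

import Mathlib

noncomputable section

namespace FibredBurnside

open CategoryTheory TensorProduct Algebra

/-! ### Isomorphism classes of finite sets with a group action, and the Burnside group -/

/-- Isomorphism of `Γ`-sets. -/
def GSetIso (Γ : Type) [Group Γ] (X Y : Type) [MulAction Γ X] [MulAction Γ Y] : Prop :=
  ∃ e : X ≃ Y, ∀ (g : Γ) (x : X), e (g • x) = g • e x

theorem GSetIso.refl {Γ : Type} [Group Γ] {X : Type} [MulAction Γ X] : GSetIso Γ X X :=
  ⟨Equiv.refl X, fun _ _ => rfl⟩

theorem GSetIso.symm {Γ : Type} [Group Γ] {X Y : Type} [MulAction Γ X] [MulAction Γ Y]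
    (h : GSetIso Γ X Y) : GSetIso Γ Y X := by
  obtain ⟨e, he⟩ := h
  exact ⟨e.symm, fun g y => by rw [Equiv.symm_apply_eq, he, Equiv.apply_symm_apply]⟩

theorem GSetIso.trans {Γ : Type} [Group Γ] {X Y Z : Type} [MulAction Γ X] [MulAction Γ Y]
    [MulAction Γ Z] (h : GSetIso Γ X Y) (h' : GSetIso Γ Y Z) : GSetIso Γ X Z := by
  obtain ⟨e, he⟩ := h
  obtain ⟨e', he'⟩ := h'
  exact ⟨e.trans e', fun g x => by simp [he, he']⟩

/-- Finite `Γ`-sets with carrier some `Fin n`, up to isomorphism. Every finite `Γ`-set is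
isomorphic to one of these, so this is the set of all isomorphism classes of finite `Γ`-sets. -/
def gsetSetoid (Γ : Type) [Group Γ] : Setoid (Σ n : ℕ, MulAction Γ (Fin n)) where
  r p q := @GSetIso Γ _ (Fin p.1) (Fin q.1) p.2 q.2
  iseqv :=
    { refl := fun p => @GSetIso.refl Γ _ (Fin p.1) p.2
      symm := fun {p q} h => @GSetIso.symm Γ _ (Fin p.1) (Fin q.1) p.2 q.2 h
      trans := fun {p q r} h h' =>
        @GSetIso.trans Γ _ (Fin p.1) (Fin q.1) (Fin r.1) p.2 q.2 r.2 h h' }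

/-- The set of isomorphism classes of finite `Γ`-sets. -/
def GSetClass (Γ : Type) [Group Γ] : Type := Quotient (gsetSetoid Γ)

/-- The isomorphism class of a finite `Γ`-set `X`. -/
def cls (Γ : Type) [Group Γ] (X : Type) [Finite X] [MulAction Γ X] : GSetClass Γ :=
  Quotient.mk (gsetSetoid Γ) ⟨Nat.card X, (Finite.equivFin X).symm.mulAction Γ⟩

section Cls

variable {Γ : Type} [Group Γ]

theorem transport_iso (X : Type) [Finite X] [MulAction Γ X] :
    @GSetIso Γ _ (Fin (Nat.card X)) X ((Finite.equivFin X).symm.mulAction Γ) _ := by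
  let := (Finite.equivFin X).symm.mulAction Γ
  exact ⟨(Finite.equivFin X).symm, fun g x => (Equiv.apply_symm_apply _ _).trans rfl⟩

theorem cls_eq_iff {X Y : Type} [Finite X] [Finite Y] [MulAction Γ X] [MulAction Γ Y] :
    cls Γ X = cls Γ Y ↔ GSetIso Γ X Y := by
  let aX := (Finite.equivFin X).symm.mulAction Γ
  let aY := (Finite.equivFin Y).symm.mulAction Γ
  have hX : GSetIso Γ (Fin (Nat.card X)) X := transport_iso X
  have hY : GSetIso Γ (Fin (Nat.card Y)) Y := transport_iso Y
  constructor
  · intro h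
    have h' : GSetIso Γ (Fin (Nat.card X)) (Fin (Nat.card Y)) := Quotient.exact h
    exact hX.symm.trans (h'.trans hY)
  · intro h
    exact Quotient.sound (s := gsetSetoid Γ) (hX.trans (h.trans hY.symm))

theorem mk_eq_cls (p : Σ n : ℕ, MulAction Γ (Fin n)) :
    Quotient.mk (gsetSetoid Γ) p = @cls Γ _ (Fin p.1) _ p.2 := by
  let := p.2
  let := (Finite.equivFin (Fin p.1)).symm.mulAction Γ
  have h : GSetIso Γ (Fin (Nat.card (Fin p.1))) (Fin p.1) := transport_iso (Fin p.1)
  exact Quotient.sound (s := gsetSetoid Γ) h.symm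

theorem cls_induction {P : GSetClass Γ → Prop}
    (h : ∀ (X : Type) [Finite X] [MulAction Γ X], P (cls Γ X)) (q : GSetClass Γ) : P q := by
  induction q using Quotient.inductionOn with
  | _ p =>
    rw [mk_eq_cls]
    let := p.2
    exact h (Fin p.1)

theorem GSetIso.sum {X X' Y Y' : Type} [MulAction Γ X] [MulAction Γ X'] [MulAction Γ Y]
    [MulAction Γ Y'] (h : GSetIso Γ X X') (h' : GSetIso Γ Y Y') :
    GSetIso Γ (X ⊕ Y) (X' ⊕ Y') := by
  obtain ⟨e, he⟩ := h
  obtain ⟨e', he'⟩ := h'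
  refine ⟨Equiv.sumCongr e e', ?_⟩
  rintro g (x | y) <;> simp [he, he']

/-- Disjoint union of isomorphism classes. -/
def clsAdd (p q : GSetClass Γ) : GSetClass Γ :=
  Quotient.liftOn₂ p q
    (fun a b => letI := a.2; letI := b.2; cls Γ (Fin a.1 ⊕ Fin b.1))
    (fun a b a' b' h h' => by
      let := a.2; let := b.2; let := a'.2; let := b'.2
      exact cls_eq_iff.2 (GSetIso.sum (Γ := Γ) h h'))

theorem clsAdd_cls (X Y : Type) [Finite X] [Finite Y] [MulAction Γ X] [MulAction Γ Y] :
    clsAdd (cls Γ X) (cls Γ Y) = cls Γ (X ⊕ Y) := by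
  let aX := (Finite.equivFin X).symm.mulAction Γ
  let aY := (Finite.equivFin Y).symm.mulAction Γ
  have hX : GSetIso Γ (Fin (Nat.card X)) X := transport_iso X
  have hY : GSetIso Γ (Fin (Nat.card Y)) Y := transport_iso Y
  exact cls_eq_iff.2 (GSetIso.sum hX hY)

instance emptyAction : MulAction Γ Empty where
  smul _ x := x
  one_smul _ := rfl
  mul_smul _ _ _ := rfl

instance : Add (GSetClass Γ) := ⟨clsAdd⟩

instance : Zero (GSetClass Γ) := ⟨cls Γ Empty⟩

instance : AddCommMonoid (GSetClass Γ) where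
  add_assoc a b c := by
    induction a using cls_induction with | _ X =>
    induction b using cls_induction with | _ Y =>
    induction c using cls_induction with | _ Z =>
    change clsAdd (clsAdd _ _) _ = clsAdd _ (clsAdd _ _)
    simp only [clsAdd_cls]
    refine cls_eq_iff.2 ⟨Equiv.sumAssoc X Y Z, ?_⟩
    rintro g ((x | x) | x) <;> rfl
  zero_add a := by
    induction a using cls_induction with | _ X =>
    change clsAdd (cls Γ Empty) _ = _
    simp only [clsAdd_cls]
    refine cls_eq_iff.2 ⟨Equiv.emptySum Empty X, ?_⟩
    rintro g (x | x)
    · exact x.elim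
    · rfl
  add_zero a := by
    induction a using cls_induction with | _ X =>
    change clsAdd _ (cls Γ Empty) = _
    simp only [clsAdd_cls]
    refine cls_eq_iff.2 ⟨Equiv.sumEmpty X Empty, ?_⟩
    rintro g (x | x)
    · rfl
    · exact x.elim
  add_comm a b := by
    induction a using cls_induction with | _ X =>
    induction b using cls_induction with | _ Y =>
    change clsAdd _ _ = clsAdd _ _
    simp only [clsAdd_cls]
    refine cls_eq_iff.2 ⟨Equiv.sumComm X Y, ?_⟩
    rintro g (x | x) <;> rfl
  nsmul := nsmulRec

theorem cls_add (X Y : Type) [Finite X] [Finite Y] [MulAction Γ X] [MulAction Γ Y] :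
    cls Γ X + cls Γ Y = cls Γ (X ⊕ Y) := clsAdd_cls X Y

theorem cls_zero : (0 : GSetClass Γ) = cls Γ Empty := rfl

end Cls

/-- The (additive group of the) Burnside ring `B(Γ)`: the Grothendieck group of the monoid of
isomorphism classes of finite `Γ`-sets under disjoint union. -/
abbrev Burnside (Γ : Type) [Group Γ] : Type := GrothendieckAddGroup (GSetClass Γ)

/-- The element of `B(Γ)` given by a finite `Γ`-set. -/
def bcls (Γ : Type) [Group Γ] (X : Type) [Finite X] [MulAction Γ X] : Burnside Γ :=
  GrothendieckAddGroup.of (cls Γ X)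

theorem burnside_induction {Γ : Type} [Group Γ] {P : Burnside Γ → Prop}
    (hs : ∀ a b, P a → P b → P (a - b))
    (h : ∀ (X : Type) [Finite X] [MulAction Γ X], P (bcls Γ X)) (q : Burnside Γ) : P q := by
  induction q using AddLocalization.ind with | _ p =>
  obtain ⟨a, b, hb⟩ := p
  have : AddLocalization.mk a ⟨b, hb⟩ =
      (GrothendieckAddGroup.of a - GrothendieckAddGroup.of b : Burnside Γ) := by
    simp only [GrothendieckAddGroup.of, AddSubmonoid.LocalizationMap.toAddMonoidHom]
    erw [← AddLocalization.mk_zero_eq_addMonoidOf_mk, ← AddLocalization.mk_zero_eq_addMonoidOf_mk,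
      GrothendieckAddGroup.mk_sub_mk]
    simp
  rw [this]
  refine hs _ _ ?_ ?_
  · induction a using cls_induction with | _ X => exact h X
  · clear this
    induction b using cls_induction with | _ X => exact h X

/-! ### The composition of fibred bisets -/

section FreePart

variable (Γ C : Type) [Group Γ] [CommGroup C]

/-- A `(Γ × C)`-set is `C`-fibred if `C` acts freely on it. -/
def IsFibred (X : Type) [MulAction (Γ × C) X] : Prop :=
  ∀ (c : C) (x : X), ((1, c) : Γ × C) • x = x → c = 1

/-- The elements of a `(Γ × C)`-set whose stabilizer in `C` is trivial. -/
def FreePart (X : Type) [MulAction (Γ × C) X] : Type :=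
  {x : X // ∀ c : C, ((1, c) : Γ × C) • x = x → c = 1}

instance (X : Type) [Finite X] [MulAction (Γ × C) X] : Finite (FreePart Γ C X) :=
  inferInstanceAs (Finite {_x : X // _})

variable {Γ C}

theorem smul_central (X : Type) [MulAction (Γ × C) X] (g : Γ × C) (c : C) (x : X) :
    ((1, c) : Γ × C) • g • x = g • ((1, c) : Γ × C) • x := by
  rw [smul_smul, smul_smul]
  congr 1
  ext <;> simp [mul_comm]

instance (X : Type) [MulAction (Γ × C) X] : MulAction (Γ × C) (FreePart Γ C X) where
  smul g x := ⟨g • x.1, fun c hc => x.2 c (by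
    rw [smul_central] at hc
    exact smul_left_cancel g hc)⟩
  one_smul x := Subtype.ext (one_smul _ x.1)
  mul_smul g h x := Subtype.ext (mul_smul g h x.1)

theorem FreePart.coe_smul {X : Type} [MulAction (Γ × C) X] (g : Γ × C) (x : FreePart Γ C X) :
    (g • x).1 = g • x.1 := rfl

theorem FreePart.isFibred (X : Type) [MulAction (Γ × C) X] : IsFibred Γ C (FreePart Γ C X) :=
  fun c x h => x.2 c (congrArg Subtype.val h)

theorem FreePart.congr {X Y : Type} [MulAction (Γ × C) X] [MulAction (Γ × C) Y]
    (h : GSetIso (Γ × C) X Y) : GSetIso (Γ × C) (FreePart Γ C X) (FreePart Γ C Y) := by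
  obtain ⟨e, he⟩ := h
  refine ⟨e.subtypeEquiv fun x => ?_, fun g x => Subtype.ext (he g x.1)⟩
  simp only [← he, e.injective.eq_iff]

theorem FreePart.of_isFibred {X : Type} [MulAction (Γ × C) X] (h : IsFibred Γ C X) :
    GSetIso (Γ × C) (FreePart Γ C X) X :=
  ⟨Equiv.subtypeUnivEquiv fun x c => h c x, fun _ _ => rfl⟩

theorem FreePart.sum (X Y : Type) [MulAction (Γ × C) X] [MulAction (Γ × C) Y] :
    GSetIso (Γ × C) (FreePart Γ C (X ⊕ Y)) (FreePart Γ C X ⊕ FreePart Γ C Y) := by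
  refine GSetIso.symm ⟨⟨Sum.elim (fun x => ⟨Sum.inl x.1, fun c hc => x.2 c (Sum.inl.inj hc)⟩)
    (fun x => ⟨Sum.inr x.1, fun c hc => x.2 c (Sum.inr.inj hc)⟩),
    fun z => match z with
      | ⟨Sum.inl x, h⟩ => Sum.inl ⟨x, fun c hc => h c (congrArg Sum.inl hc)⟩
      | ⟨Sum.inr x, h⟩ => Sum.inr ⟨x, fun c hc => h c (congrArg Sum.inr hc)⟩, ?_, ?_⟩, ?_⟩
  · rintro (x | x) <;> rfl
  · rintro ⟨x | x, h⟩ <;> rfl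
  · rintro g (x | x) <;> rfl

end FreePart

section Orb

variable (G H K C : Type) [Group G] [Group H] [Group K] [CommGroup C]
variable (T Y : Type) [MulAction ((G × H) × C) T] [MulAction ((H × K) × C) Y]

/-- The orbit relation on `T × Y` of the action
`(h, c) (t, y) = ((h, c) t, (h, c⁻¹) y)` of `H × C`. -/
def orbSetoid : Setoid (T × Y) where
  r p q := ∃ (h : H) (c : C),
    q = ((((1, h), c) : (G × H) × C) • p.1, (((h, 1), c⁻¹) : (H × K) × C) • p.2)
  iseqv :=
    { refl := fun p => ⟨1, 1, by
        ext
        · exact (one_smul ((G × H) × C) p.1).symm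
        · rw [inv_one]
          exact (one_smul ((H × K) × C) p.2).symm⟩
      symm := by
        rintro p q ⟨h, c, rfl⟩
        refine ⟨h⁻¹, c⁻¹, ?_⟩
        ext <;> simp [smul_smul, ← Prod.one_eq_mk]
      trans := by
        rintro p q r ⟨h, c, rfl⟩ ⟨h', c', rfl⟩
        refine ⟨h' * h, c' * c, ?_⟩
        ext <;> simp [smul_smul, mul_comm] }

/-- The set of orbits of `T × Y` under `H × C`. -/
def Orb : Type := Quotient (orbSetoid G H K C T Y)

instance [Finite T] [Finite Y] : Finite (Orb G H K C T Y) :=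
  inferInstanceAs (Finite (Quotient _))

variable {T Y}

/-- The orbit of `(t, y)`. -/
def Orb.mk (t : T) (y : Y) : Orb G H K C T Y := Quotient.mk (orbSetoid G H K C T Y) (t, y)

variable {G H K C}

theorem Orb.mk_eq_iff {t t' : T} {y y' : Y} : Orb.mk G H K C t y = Orb.mk G H K C t' y' ↔
    ∃ (h : H) (c : C), t' = (((1, h), c) : (G × H) × C) • t ∧
      y' = (((h, 1), c⁻¹) : (H × K) × C) • y := by
  refine (Quotient.eq (r := orbSetoid G H K C T Y)).trans ?_
  exact exists_congr fun h => exists_congr fun c => Prod.ext_iff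

theorem Orb.ind {P : Orb G H K C T Y → Prop} (h : ∀ t y, P (Orb.mk G H K C t y)) (w) : P w :=
  Quotient.inductionOn w fun p => h p.1 p.2

/-- The function on orbits induced by an invariant function on pairs. -/
def Orb.lift {Z : Type} (f : T → Y → Z)
    (hf : ∀ t y (h : H) (c : C), f ((((1, h), c) : (G × H) × C) • t)
      ((((h, 1), c⁻¹) : (H × K) × C) • y) = f t y) : Orb G H K C T Y → Z :=
  Quotient.lift (fun p => f p.1 p.2) (by
    rintro p q ⟨h, c, rfl⟩
    exact (hf _ _ _ _).symm)

theorem Orb.lift_mk {Z : Type} (f : T → Y → Z) (hf) (t : T) (y : Y) :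
    Orb.lift f hf (Orb.mk G H K C t y) = f t y := rfl

theorem Orb.sound (t : T) (y : Y) (h : H) (c : C) :
    Orb.mk G H K C ((((1, h), c) : (G × H) × C) • t) ((((h, 1), c⁻¹) : (H × K) × C) • y) =
      Orb.mk G H K C t y :=
  (Orb.mk_eq_iff.2 ⟨h, c, rfl, rfl⟩).symm

/-- `G` acts on the first coordinate, `K` on the second one, and `C` by
`c [t, y] = [c t, y] = [t, c y]`. -/
instance : MulAction ((G × K) × C) (Orb G H K C T Y) where
  smul g := Orb.lift (fun t y => Orb.mk G H K C ((((g.1.1, 1), g.2) : (G × H) × C) • t)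
      ((((1, g.1.2), 1) : (H × K) × C) • y)) (by
    intro t y h c
    refine Eq.trans ?_ (Orb.sound _ _ h c)
    simp [smul_smul, mul_comm])
  one_smul := Orb.ind fun t y => by
    change Orb.mk G H K C _ _ = _
    simp [← Prod.one_eq_mk]
  mul_smul g g' := Orb.ind fun t y => by
    change Orb.mk G H K C _ _ = Orb.mk G H K C _ _
    simp [smul_smul]

theorem Orb.smul_mk (g : G) (k : K) (c : C) (t : T) (y : Y) :
    (((g, k), c) : (G × K) × C) • Orb.mk G H K C t y =
      Orb.mk G H K C ((((g, 1), c) : (G × H) × C) • t) ((((1, k), 1) : (H × K) × C) • y) := rfl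

theorem Orb.smul_mk' (g : G) (k : K) (c : C) (t : T) (y : Y) :
    (((g, k), c) : (G × K) × C) • Orb.mk G H K C t y =
      Orb.mk G H K C ((((g, 1), 1) : (G × H) × C) • t) ((((1, k), c) : (H × K) × C) • y) := by
  rw [Orb.smul_mk, ← Orb.sound _ _ 1 c⁻¹]
  simp [smul_smul]

end Orb

section OrbIso

variable {G H K L C : Type} [Group G] [Group H] [Group K] [Group L] [CommGroup C]

theorem Orb.congr {T T' Y Y' : Type} [MulAction ((G × H) × C) T] [MulAction ((G × H) × C) T']
    [MulAction ((H × K) × C) Y] [MulAction ((H × K) × C) Y']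
    (hT : GSetIso ((G × H) × C) T T') (hY : GSetIso ((H × K) × C) Y Y') :
    GSetIso ((G × K) × C) (Orb G H K C T Y) (Orb G H K C T' Y') := by
  obtain ⟨e, he⟩ := hT
  obtain ⟨f, hf⟩ := hY
  refine ⟨Quotient.congr (e.prodCongr f) ?_, ?_⟩
  · rintro ⟨t, y⟩ ⟨t', y'⟩
    change (∃ _, _) ↔ (∃ _, _)
    simp [← he, ← hf]
  · rintro ⟨⟨g, k⟩, c⟩ w
    induction w using Orb.ind with | _ t y =>
    change Orb.mk G H K C _ _ = Orb.mk G H K C _ _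
    rw [he, hf]
    rfl

theorem Orb.sum_left (T T' Y : Type) [MulAction ((G × H) × C) T] [MulAction ((G × H) × C) T']
    [MulAction ((H × K) × C) Y] :
    GSetIso ((G × K) × C) (Orb G H K C (T ⊕ T') Y) (Orb G H K C T Y ⊕ Orb G H K C T' Y) := by
  refine ⟨⟨Orb.lift (fun t y => t.elim (fun t => Sum.inl (Orb.mk G H K C t y))
      (fun t => Sum.inr (Orb.mk G H K C t y))) ?_,
    Sum.elim (Orb.lift (fun t y => Orb.mk G H K C (Sum.inl t) y) ?_)
      (Orb.lift (fun t y => Orb.mk G H K C (Sum.inr t) y) ?_), ?_, ?_⟩, ?_⟩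
  · rintro (t | t) y h c
    · exact congrArg Sum.inl (Orb.sound t y h c)
    · exact congrArg Sum.inr (Orb.sound t y h c)
  · intro t y h c
    exact Orb.sound (Sum.inl t : T ⊕ T') y h c
  · intro t y h c
    exact Orb.sound (Sum.inr t : T ⊕ T') y h c
  · refine Orb.ind ?_
    rintro (t | t) y <;> rfl
  · rintro (w | w) <;> induction w using Orb.ind <;> rfl
  · rintro ⟨⟨g, k⟩, c⟩ w
    induction w using Orb.ind with | _ t y =>
    rcases t with t | t <;> rfl

theorem Orb.sum_right (T Y Y' : Type) [MulAction ((G × H) × C) T] [MulAction ((H × K) × C) Y]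
    [MulAction ((H × K) × C) Y'] :
    GSetIso ((G × K) × C) (Orb G H K C T (Y ⊕ Y')) (Orb G H K C T Y ⊕ Orb G H K C T Y') := by
  refine ⟨⟨Orb.lift (fun t y => y.elim (fun y => Sum.inl (Orb.mk G H K C t y))
      (fun y => Sum.inr (Orb.mk G H K C t y))) ?_,
    Sum.elim (Orb.lift (fun t y => Orb.mk G H K C t (Sum.inl y)) ?_)
      (Orb.lift (fun t y => Orb.mk G H K C t (Sum.inr y)) ?_), ?_, ?_⟩, ?_⟩
  · rintro t (y | y) h c
    · exact congrArg Sum.inl (Orb.sound t y h c)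
    · exact congrArg Sum.inr (Orb.sound t y h c)
  · intro t y h c
    exact Orb.sound t (Sum.inl y : Y ⊕ Y') h c
  · intro t y h c
    exact Orb.sound t (Sum.inr y : Y ⊕ Y') h c
  · refine Orb.ind ?_
    rintro t (y | y) <;> rfl
  · rintro (w | w) <;> induction w using Orb.ind <;> rfl
  · rintro ⟨⟨g, k⟩, c⟩ w
    induction w using Orb.ind with | _ t y =>
    rcases y with y | y <;> rfl

theorem Orb.assoc (T Y Z : Type) [MulAction ((G × H) × C) T] [MulAction ((H × K) × C) Y]
    [MulAction ((K × L) × C) Z] :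
    GSetIso ((G × L) × C) (Orb G K L C (Orb G H K C T Y) Z)
      (Orb G H L C T (Orb H K L C Y Z)) := by
  refine ⟨⟨Orb.lift (fun w z => Orb.lift
      (fun t y => Orb.mk G H L C t (Orb.mk H K L C y z)) ?_ w) ?_,
    Orb.lift (fun t w => Orb.lift
      (fun y z => Orb.mk G K L C (Orb.mk G H K C t y) z) ?_ w) ?_, ?_, ?_⟩, ?_⟩
  · intro t y h c
    refine Eq.trans ?_ (Orb.sound _ _ h c)
    rw [Orb.smul_mk]
    simp [← Prod.one_eq_mk]
  · intro w z k c
    induction w using Orb.ind with | _ t y =>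
    rw [Orb.smul_mk']
    simp only [Orb.lift_mk]
    rw [Orb.sound]
    simp [← Prod.one_eq_mk]
  · intro y z k c
    refine Eq.trans ?_ (Orb.sound _ _ k c)
    rw [Orb.smul_mk']
    simp [← Prod.one_eq_mk]
  · intro t w h c
    induction w using Orb.ind with | _ y z =>
    rw [Orb.smul_mk]
    simp only [Orb.lift_mk]
    rw [Orb.sound]
    simp [← Prod.one_eq_mk]
  · refine Orb.ind fun w z => ?_
    induction w using Orb.ind with | _ t y => rfl
  · refine Orb.ind fun t w => ?_
    induction w using Orb.ind with | _ y z => rfl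
  · rintro ⟨⟨g, l⟩, c⟩ w
    induction w using Orb.ind with | _ w z =>
    induction w using Orb.ind with | _ t y =>
    change Orb.mk G H L C _ (Orb.mk H K L C _ _) = Orb.mk G H L C _ (Orb.mk H K L C _ _)
    simp [← Prod.one_eq_mk]

/-- Taking the free part of the left factor first does not change the free part of the orbits. -/
theorem Orb.free_left (T Y : Type) [MulAction ((G × H) × C) T] [MulAction ((H × K) × C) Y] :
    GSetIso ((G × K) × C) (FreePart (G × K) C (Orb G H K C (FreePart (G × H) C T) Y))
      (FreePart (G × K) C (Orb G H K C T Y)) := by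
  let f : Orb G H K C (FreePart (G × H) C T) Y → Orb G H K C T Y :=
    Orb.lift (fun t y => Orb.mk G H K C t.1 y) (fun t y h c => Orb.sound t.1 y h c)
  have hf : ∀ (g : (G × K) × C) w, f (g • w) = g • f w := by
    rintro ⟨⟨g, k⟩, c⟩ w
    induction w using Orb.ind with | _ t y => rfl
  have inj : Function.Injective f := by
    intro w w' hw
    induction w using Orb.ind with | _ t y =>
    induction w' using Orb.ind with | _ t' y' =>
    obtain ⟨h, c, h1, h2⟩ := Orb.mk_eq_iff.1 hw
    exact Orb.mk_eq_iff.2 ⟨h, c, Subtype.ext h1, h2⟩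
  refine ⟨Equiv.ofBijective (fun w => ⟨f w.1, fun c hc => w.2 c (inj ((hf _ _).trans hc))⟩)
    ⟨?_, ?_⟩, fun g w => Subtype.ext (hf g w.1)⟩
  · intro w w' hw
    exact Subtype.ext (inj (congrArg Subtype.val hw))
  · rintro ⟨w, hw⟩
    induction w using Orb.ind with | _ t y =>
    have ht : ∀ c : C, ((1, c) : (G × H) × C) • t = t → c = 1 := by
      intro c hc
      refine hw c ?_
      change Orb.mk G H K C (((1, c) : (G × H) × C) • t) ((1 : (H × K) × C) • y) = _
      rw [hc, one_smul]
    refine ⟨⟨Orb.mk G H K C ⟨t, ht⟩ y, fun c hc => hw c ?_⟩, rfl⟩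
    exact (hf _ _).symm.trans (congrArg f hc)

/-- Taking the free part of the right factor first does not change the free part of the orbits. -/
theorem Orb.free_right (T Y : Type) [MulAction ((G × H) × C) T] [MulAction ((H × K) × C) Y] :
    GSetIso ((G × K) × C) (FreePart (G × K) C (Orb G H K C T (FreePart (H × K) C Y)))
      (FreePart (G × K) C (Orb G H K C T Y)) := by
  let f : Orb G H K C T (FreePart (H × K) C Y) → Orb G H K C T Y :=
    Orb.lift (fun t y => Orb.mk G H K C t y.1) (fun t y h c => Orb.sound t y.1 h c)
  have hf : ∀ (g : (G × K) × C) w, f (g • w) = g • f w := by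
    rintro ⟨⟨g, k⟩, c⟩ w
    induction w using Orb.ind with | _ t y => rfl
  have inj : Function.Injective f := by
    intro w w' hw
    induction w using Orb.ind with | _ t y =>
    induction w' using Orb.ind with | _ t' y' =>
    obtain ⟨h, c, h1, h2⟩ := Orb.mk_eq_iff.1 hw
    exact Orb.mk_eq_iff.2 ⟨h, c, h1, Subtype.ext h2⟩
  refine ⟨Equiv.ofBijective (fun w => ⟨f w.1, fun c hc => w.2 c (inj ((hf _ _).trans hc))⟩)
    ⟨?_, ?_⟩, fun g w => Subtype.ext (hf g w.1)⟩
  · intro w w' hw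
    exact Subtype.ext (inj (congrArg Subtype.val hw))
  · rintro ⟨w, hw⟩
    induction w using Orb.ind with | _ t y =>
    have hy : ∀ c : C, ((1, c) : (H × K) × C) • y = y → c = 1 := by
      intro c hc
      refine hw c ?_
      refine (Orb.smul_mk' 1 1 c t y).trans ?_
      change Orb.mk G H K C ((1 : (G × H) × C) • t) (((1, c) : (H × K) × C) • y) = _
      rw [hc, one_smul]
    refine ⟨⟨Orb.mk G H K C t ⟨y, hy⟩, fun c hc => hw c ?_⟩, rfl⟩
    exact (hf _ _).symm.trans (congrArg f hc)

end OrbIso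

section Transitive

variable {Γ C : Type} [Group Γ] [CommGroup C]

/-- The subgroup `D_δ = {(a, δ(a)⁻¹) | a ∈ D}` of `Γ × C`. -/
def twist (D : Subgroup Γ) (δ : D →* C) : Subgroup (Γ × C) where
  carrier := {p | ∃ h : p.1 ∈ D, p.2 = (δ ⟨p.1, h⟩)⁻¹}
  one_mem' := ⟨D.one_mem, by
    change (1 : C) = (δ 1)⁻¹
    simp⟩
  mul_mem' := by
    rintro p q ⟨hp, hp'⟩ ⟨hq, hq'⟩
    refine ⟨D.mul_mem hp hq, ?_⟩
    have : (⟨(p * q).1, D.mul_mem hp hq⟩ : D) = ⟨p.1, hp⟩ * ⟨q.1, hq⟩ := rfl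
    rw [this, map_mul, mul_inv, ← hp', ← hq']
    rfl
  inv_mem' := by
    rintro p ⟨hp, hp'⟩
    refine ⟨D.inv_mem hp, ?_⟩
    have : (⟨p⁻¹.1, D.inv_mem hp⟩ : D) = (⟨p.1, hp⟩)⁻¹ := rfl
    rw [this, map_inv, ← hp']
    rfl

/-- The transitive `C`-fibred `Γ`-set `C_δ Γ/D = (Γ × C)/D_δ`. -/
abbrev FibredCoset (D : Subgroup Γ) (δ : D →* C) : Type := (Γ × C) ⧸ twist D δ

theorem isFibred_fibredCoset (D : Subgroup Γ) (δ : D →* C) :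
    IsFibred Γ C (FibredCoset D δ) := by
  intro c x hx
  induction x using QuotientGroup.induction_on with | _ p =>
  have h := QuotientGroup.eq.1 hx
  obtain ⟨h1, h2⟩ := inv_mem h
  simp only [smul_eq_mul, mul_inv_rev, inv_inv, Prod.snd_mul, Prod.snd_inv, Prod.fst_mul,
    Prod.fst_inv, one_mul, inv_mul_cancel] at h1 h2
  have h3 : (⟨1, h1⟩ : D) = 1 := rfl
  rw [h3, map_one, inv_one, mul_comm c, inv_mul_cancel_left] at h2
  exact h2

end Transitive

section Identity

variable {G H C : Type} [Group G] [Group H] [CommGroup C]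

/-- The graph `{(φ g, g) | g ∈ G}`, a subgroup of `H × G`. -/
def graph (φ : G →* H) : Subgroup (H × G) := (φ.prod (MonoidHom.id G)).range

theorem mem_twist_diag {p : (G × G) × C} :
    p ∈ twist (graph (MonoidHom.id G)) (1 : graph (MonoidHom.id G) →* C) ↔
      p.1.1 = p.1.2 ∧ p.2 = 1 := by
  obtain ⟨⟨a, b⟩, c⟩ := p
  constructor
  · rintro ⟨⟨x, hx⟩, h⟩
    simp only [MonoidHom.prod_apply, MonoidHom.id_apply, Prod.mk.injEq] at hx
    exact ⟨hx.1.symm.trans hx.2, by simpa using h⟩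
  · rintro ⟨h, h'⟩
    refine ⟨⟨a, ?_⟩, by simpa using h'⟩
    simpa using h

theorem Orb.id_left (Y : Type) [MulAction ((G × H) × C) Y] :
    GSetIso ((G × H) × C)
      (Orb G G H C (FibredCoset (graph (MonoidHom.id G)) (1 : _ →* C)) Y) Y := by
  refine ⟨⟨Orb.lift (fun t y => Quotient.liftOn' t
      (fun p => (((p.1.1 * p.1.2⁻¹, 1), p.2) : (G × H) × C) • y) ?_) ?_,
    fun y => Orb.mk G G H C (QuotientGroup.mk 1) y, ?_, ?_⟩, ?_⟩
  · intro p q hpq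
    obtain ⟨h1, h2⟩ := mem_twist_diag.1 (QuotientGroup.leftRel_apply.1 hpq)
    have h3 : p.1.1 * p.1.2⁻¹ = q.1.1 * q.1.2⁻¹ := by
      have : p.1.1⁻¹ * q.1.1 = p.1.2⁻¹ * q.1.2 := h1
      rw [inv_mul_eq_iff_eq_mul] at this
      rw [this]
      group
    have h4 : p.2 = q.2 := (inv_mul_eq_one.1 h2)
    simp only [h3, h4]
  · intro t y h c
    induction t using QuotientGroup.induction_on with | _ p =>
    change (((1 * p.1.1 * (h * p.1.2)⁻¹, 1), c * p.2) : (G × H) × C) •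
      (((h, 1), c⁻¹) : (G × H) × C) • y = (((p.1.1 * p.1.2⁻¹, 1), p.2) : (G × H) × C) • y
    rw [smul_smul]
    congr 1
    ext <;> simp [mul_assoc]
  · refine Orb.ind fun t y => ?_
    induction t using QuotientGroup.induction_on with | _ p =>
    refine Eq.symm (Orb.mk_eq_iff.2 ⟨p.1.1 * p.1.2⁻¹, p.2⁻¹, ?_, ?_⟩)
    · refine QuotientGroup.eq.2 (mem_twist_diag.2 ?_)
      simp [smul_eq_mul]
    · rw [inv_inv]
      rfl
  · intro y
    change (((1 * 1⁻¹, 1), 1) : (G × H) × C) • y = y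
    simp [← Prod.one_eq_mk]
  · rintro ⟨⟨g, h⟩, c⟩ w
    induction w using Orb.ind with | _ t y =>
    induction t using QuotientGroup.induction_on with | _ p =>
    change (((g * p.1.1 * (1 * p.1.2)⁻¹, 1), c * p.2) : (G × H) × C) •
      (((1, h), 1) : (G × H) × C) • y =
      (((g, h), c) : (G × H) × C) • (((p.1.1 * p.1.2⁻¹, 1), p.2) : (G × H) × C) • y
    rw [smul_smul, smul_smul]
    congr 1
    ext <;> simp [mul_assoc]

theorem Orb.id_right (T : Type) [MulAction ((G × H) × C) T] :
    GSetIso ((G × H) × C)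
      (Orb G H H C T (FibredCoset (graph (MonoidHom.id H)) (1 : _ →* C))) T := by
  refine ⟨⟨Orb.lift (fun t y => Quotient.liftOn' y
      (fun p => (((1, p.1.2 * p.1.1⁻¹), p.2) : (G × H) × C) • t) ?_) ?_,
    fun t => Orb.mk G H H C t (QuotientGroup.mk 1), ?_, ?_⟩, ?_⟩
  · intro p q hpq
    obtain ⟨h1, h2⟩ := mem_twist_diag.1 (QuotientGroup.leftRel_apply.1 hpq)
    have h3 : p.1.2 * p.1.1⁻¹ = q.1.2 * q.1.1⁻¹ := by
      have : p.1.1⁻¹ * q.1.1 = p.1.2⁻¹ * q.1.2 := h1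
      rw [inv_mul_eq_iff_eq_mul] at this
      rw [this]
      group
    have h4 : p.2 = q.2 := (inv_mul_eq_one.1 h2)
    simp only [h3, h4]
  · intro t y h c
    induction y using QuotientGroup.induction_on with | _ p =>
    change (((1, 1 * p.1.2 * (h * p.1.1)⁻¹), c⁻¹ * p.2) : (G × H) × C) •
      (((1, h), c) : (G × H) × C) • t = (((1, p.1.2 * p.1.1⁻¹), p.2) : (G × H) × C) • t
    rw [smul_smul]
    congr 1
    ext <;> simp [mul_assoc, mul_comm]
  · refine Orb.ind fun t y => ?_
    induction y using QuotientGroup.induction_on with | _ p =>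
    refine Eq.symm (Orb.mk_eq_iff.2 ⟨p.1.2 * p.1.1⁻¹, p.2, ?_, ?_⟩)
    · rfl
    · refine QuotientGroup.eq.2 (mem_twist_diag.2 ?_)
      simp [smul_eq_mul]
  · intro y
    change (((1, 1 * 1⁻¹), 1) : (G × H) × C) • y = y
    simp [← Prod.one_eq_mk]
  · rintro ⟨⟨g, h⟩, c⟩ w
    induction w using Orb.ind with | _ t y =>
    induction y using QuotientGroup.induction_on with | _ p =>
    change (((1, h * p.1.2 * (1 * p.1.1)⁻¹), 1 * p.2) : (G × H) × C) •
      (((g, 1), c) : (G × H) × C) • t =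
      (((g, h), c) : (G × H) × C) • (((1, p.1.2 * p.1.1⁻¹), p.2) : (G × H) × C) • t
    rw [smul_smul, smul_smul]
    congr 1
    ext <;> simp [mul_assoc, mul_comm]

end Identity

section ClassComp

variable (G H K L C : Type) [Group G] [Group H] [Group K] [Group L] [CommGroup C]

/-- The underlying set of the composition `T ∘ Y`: the orbits of `T × Y` under `H × C` on which
`C` acts freely. -/
abbrev CompSet (T Y : Type) [MulAction ((G × H) × C) T] [MulAction ((H × K) × C) Y] : Type :=
  FreePart (G × K) C (Orb G H K C T Y)

/-- Composition of isomorphism classes. -/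
def compClsFun (p : GSetClass ((G × H) × C)) (q : GSetClass ((H × K) × C)) :
    GSetClass ((G × K) × C) :=
  Quotient.liftOn₂ p q
    (fun a b => letI := a.2; letI := b.2; cls ((G × K) × C) (CompSet G H K C (Fin a.1) (Fin b.1)))
    (fun a b a' b' h h' => by
      let := a.2; let := b.2; let := a'.2; let := b'.2
      exact cls_eq_iff.2 (FreePart.congr (Orb.congr h h')))

theorem compClsFun_cls (T Y : Type) [Finite T] [Finite Y] [MulAction ((G × H) × C) T]
    [MulAction ((H × K) × C) Y] :
    compClsFun G H K C (cls _ T) (cls _ Y) = cls _ (CompSet G H K C T Y) := by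
  let aX := (Finite.equivFin T).symm.mulAction ((G × H) × C)
  let aY := (Finite.equivFin Y).symm.mulAction ((H × K) × C)
  have hX : GSetIso ((G × H) × C) (Fin (Nat.card T)) T := transport_iso T
  have hY : GSetIso ((H × K) × C) (Fin (Nat.card Y)) Y := transport_iso Y
  exact cls_eq_iff.2 (FreePart.congr (Orb.congr hX hY))

theorem compClsFun_add_left (p p' : GSetClass ((G × H) × C)) (q : GSetClass ((H × K) × C)) :
    compClsFun G H K C (p + p') q = compClsFun G H K C p q + compClsFun G H K C p' q := by
  induction p using cls_induction with | _ T =>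
  induction p' using cls_induction with | _ T' =>
  induction q using cls_induction with | _ Y =>
  rw [cls_add, compClsFun_cls, compClsFun_cls, compClsFun_cls, cls_add]
  exact cls_eq_iff.2 ((FreePart.congr (Orb.sum_left T T' Y)).trans (FreePart.sum _ _))

theorem compClsFun_add_right (p : GSetClass ((G × H) × C)) (q q' : GSetClass ((H × K) × C)) :
    compClsFun G H K C p (q + q') = compClsFun G H K C p q + compClsFun G H K C p q' := by
  induction p using cls_induction with | _ T =>
  induction q using cls_induction with | _ Y =>
  induction q' using cls_induction with | _ Y' =>
  rw [cls_add, compClsFun_cls, compClsFun_cls, compClsFun_cls, cls_add]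
  exact cls_eq_iff.2 ((FreePart.congr (Orb.sum_right T Y Y')).trans (FreePart.sum _ _))

theorem compClsFun_zero_left (q : GSetClass ((H × K) × C)) :
    compClsFun G H K C 0 q = 0 := by
  induction q using cls_induction with | _ Y =>
  rw [cls_zero, compClsFun_cls, cls_zero]
  have e : CompSet G H K C Empty Y → Empty := fun w => Orb.lift (fun t _ => t)
    (fun t _ _ _ => t.elim) w.1
  exact cls_eq_iff.2 ⟨⟨e, fun x => x.elim, fun x => (e x).elim, fun x => x.elim⟩,
    fun _ x => (e x).elim⟩

theorem compClsFun_zero_right (p : GSetClass ((G × H) × C)) :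
    compClsFun G H K C p 0 = 0 := by
  induction p using cls_induction with | _ T =>
  rw [cls_zero, compClsFun_cls, cls_zero]
  have e : CompSet G H K C T Empty → Empty := fun w => Orb.lift (fun _ y => y)
    (fun _ y _ _ => y.elim) w.1
  exact cls_eq_iff.2 ⟨⟨e, fun x => x.elim, fun x => (e x).elim, fun x => x.elim⟩,
    fun _ x => (e x).elim⟩

/-- Composition of isomorphism classes as a biadditive map. -/
def compCls : GSetClass ((G × H) × C) →+ GSetClass ((H × K) × C) →+ GSetClass ((G × K) × C) where
  toFun p :=
    { toFun := compClsFun G H K C p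
      map_zero' := compClsFun_zero_right G H K C p
      map_add' := compClsFun_add_right G H K C p }
  map_zero' := AddMonoidHom.ext (compClsFun_zero_left G H K C)
  map_add' p p' := AddMonoidHom.ext (compClsFun_add_left G H K C p p')

theorem lift_of {M A : Type} [AddCommMonoid M] [AddCommGroup A] (f : M →+ A) (m : M) :
    GrothendieckAddGroup.lift f (GrothendieckAddGroup.of m) = f m :=
  DFunLike.congr_fun (GrothendieckAddGroup.lift.symm_apply_apply f) m

theorem hom_ext_of {M A : Type} [AddCommMonoid M] [AddCommGroup A]
    {f g : GrothendieckAddGroup M →+ A}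
    (h : ∀ m : M, f (GrothendieckAddGroup.of m) = g (GrothendieckAddGroup.of m)) : f = g :=
  GrothendieckAddGroup.lift.symm.injective (AddMonoidHom.ext h)

/-- Extension of a biadditive map from commutative monoids to their Grothendieck groups. -/
def liftBiadditive {M N P : Type} [AddCommMonoid M] [AddCommMonoid N] [AddCommMonoid P]
    (f : M →+ N →+ P) :
    GrothendieckAddGroup M →+ GrothendieckAddGroup N →+ GrothendieckAddGroup P :=
  GrothendieckAddGroup.lift
    { toFun := fun m => GrothendieckAddGroup.lift (GrothendieckAddGroup.of.comp (f m))
      map_zero' := hom_ext_of fun n => by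
        rw [lift_of, map_zero, AddMonoidHom.comp_zero]
        rfl
      map_add' := fun m m' => hom_ext_of fun n => by
        rw [AddMonoidHom.add_apply, lift_of, lift_of, lift_of, map_add, AddMonoidHom.comp_add]
        rfl }

theorem liftBiadditive_of {M N P : Type} [AddCommMonoid M] [AddCommMonoid N] [AddCommMonoid P]
    (f : M →+ N →+ P) (m : M) (n : N) :
    liftBiadditive f (GrothendieckAddGroup.of m) (GrothendieckAddGroup.of n) =
      GrothendieckAddGroup.of (f m n) := by
  rw [liftBiadditive, lift_of]
  exact lift_of _ n

/-- The biadditive extension to Burnside groups of the composition of sets. -/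
def compB : Burnside ((G × H) × C) →+ Burnside ((H × K) × C) →+ Burnside ((G × K) × C) :=
  liftBiadditive (compCls G H K C)

theorem compB_bcls (T Y : Type) [Finite T] [Finite Y] [MulAction ((G × H) × C) T]
    [MulAction ((H × K) × C) Y] :
    compB G H K C (bcls _ T) (bcls _ Y) = bcls _ (CompSet G H K C T Y) :=
  (liftBiadditive_of _ _ _).trans
    (congrArg GrothendieckAddGroup.of (compClsFun_cls G H K C T Y))

theorem bcls_congr {Γ X Y : Type} [Group Γ] [Finite X] [Finite Y] [MulAction Γ X] [MulAction Γ Y]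
    (h : GSetIso Γ X Y) : bcls Γ X = bcls Γ Y :=
  congrArg GrothendieckAddGroup.of (cls_eq_iff.2 h)

theorem compB_assoc (a : Burnside ((G × H) × C)) (b : Burnside ((H × K) × C))
    (c : Burnside ((K × L) × C)) :
    compB G K L C (compB G H K C a b) c = compB G H L C a (compB H K L C b c) := by
  induction a using burnside_induction with
  | hs a a' h h' => simp [h, h']
  | h T =>
  induction b using burnside_induction with
  | hs a a' h h' => simp [h, h']
  | h Y =>
  induction c using burnside_induction with
  | hs a a' h h' => simp [h, h']
  | h Z =>
  simp only [compB_bcls]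
  refine bcls_congr ?_
  exact (Orb.free_left (Orb G H K C T Y) Z).trans
    ((FreePart.congr (Orb.assoc T Y Z)).trans (Orb.free_right T (Orb H K L C Y Z)).symm)

end ClassComp

/-! ### The monomial Burnside group and its scalar extension -/

section Monomial

variable (C Γ : Type) [CommGroup C] [Group Γ]

/-- The monomial Burnside group `B_C^1(Γ)`: the subgroup of `B(Γ × C)` generated by the
`C`-fibred `Γ`-sets. -/
def monomialBurnside : AddSubgroup (Burnside (Γ × C)) :=
  AddSubgroup.closure {b | ∃ (X : Type) (_ : Finite X) (_ : MulAction (Γ × C) X),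
    IsFibred Γ C X ∧ b = bcls (Γ × C) X}

variable {C Γ}

theorem bcls_mem {X : Type} [Finite X] [MulAction (Γ × C) X] (h : IsFibred Γ C X) :
    bcls (Γ × C) X ∈ monomialBurnside C Γ :=
  AddSubgroup.subset_closure ⟨X, inferInstance, inferInstance, h, rfl⟩

theorem compB_mem {G H K : Type} [Group G] [Group H] [Group K]
    (a : Burnside ((G × H) × C)) (b : Burnside ((H × K) × C)) :
    compB G H K C a b ∈ monomialBurnside C (G × K) := by
  induction a using burnside_induction with
  | hs a a' h h' =>
    rw [map_sub, AddMonoidHom.sub_apply]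
    exact sub_mem h h'
  | h T =>
  induction b using burnside_induction with
  | hs a a' h h' =>
    rw [map_sub]
    exact sub_mem h h'
  | h Y =>
  rw [compB_bcls]
  exact bcls_mem (FreePart.isFibred _)

/-- Composition `B_C^1(G × H) × B_C^1(H × K) → B_C^1(G × K)`. -/
def compM (G H K C : Type) [Group G] [Group H] [Group K] [CommGroup C] :
    monomialBurnside C (G × H) →ₗ[ℤ] monomialBurnside C (H × K) →ₗ[ℤ]
      monomialBurnside C (G × K) :=
  LinearMap.mk₂ ℤ (fun a b => ⟨compB G H K C a.1 b.1, compB_mem a.1 b.1⟩)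
    (fun a a' b => Subtype.ext (by simp))
    (fun n a b => Subtype.ext (by simp))
    (fun a b b' => Subtype.ext (by simp))
    (fun n a b => Subtype.ext (by simp))

theorem compM_coe {G H K : Type} [Group G] [Group H] [Group K]
    (a : monomialBurnside C (G × H)) (b : monomialBurnside C (H × K)) :
    (compM G H K C a b : Burnside ((G × K) × C)) = compB G H K C a.1 b.1 := rfl

/-- The class of the transitive fibred set `C_δ Γ/D` in `B_C^1(Γ)`. -/
def transM [Finite Γ] [Finite C] (D : Subgroup Γ) (δ : D →* C) : monomialBurnside C Γ :=
  ⟨bcls (Γ × C) (FibredCoset D δ), bcls_mem (isFibred_fibredCoset D δ)⟩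

theorem compM_id_left {G H : Type} [Group G] [Group H] [Finite G] [Finite C]
    (b : monomialBurnside C (G × H)) :
    compM G G H C (transM (graph (MonoidHom.id G)) 1) b = b := by
  apply Subtype.ext
  rw [compM_coe]
  obtain ⟨b, hb⟩ := b
  induction hb using AddSubgroup.closure_induction with
  | zero => simp
  | add x y hx hy h h' => simpa using congrArg₂ (· + ·) h h'
  | neg x hx h => simpa using h
  | mem x hx =>
    obtain ⟨Y, _, _, hY, rfl⟩ := hx
    exact (compB_bcls G G H C _ Y).trans (bcls_congr
      ((FreePart.congr (Orb.id_left Y)).trans (FreePart.of_isFibred hY)))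

theorem compM_id_right {G H : Type} [Group G] [Group H] [Finite H] [Finite C]
    (a : monomialBurnside C (G × H)) :
    compM G H H C a (transM (graph (MonoidHom.id H)) 1) = a := by
  apply Subtype.ext
  rw [compM_coe]
  obtain ⟨a, ha⟩ := a
  induction ha using AddSubgroup.closure_induction with
  | zero => simp
  | add x y hx hy h h' => simpa using congrArg₂ (· + ·) h h'
  | neg x hx h => simpa using h
  | mem x hx =>
    obtain ⟨T, _, _, hT, rfl⟩ := hx
    exact (compB_bcls G H H C T _).trans (bcls_congr
      ((FreePart.congr (Orb.id_right T)).trans (FreePart.of_isFibred hT)))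

theorem compM_assoc {G H K L : Type} [Group G] [Group H] [Group K] [Group L]
    (a : monomialBurnside C (G × H)) (b : monomialBurnside C (H × K))
    (c : monomialBurnside C (K × L)) :
    compM G K L C (compM G H K C a b) c = compM G H L C a (compM H K L C b c) :=
  Subtype.ext (compB_assoc G H K L C a.1 b.1 c.1)

end Monomial

universe u

section Coefficients

variable (R : Type u) [CommRing R]

/-- The monomial Burnside group with coefficients, `R B_C^1(Γ) = R ⊗ B_C^1(Γ)`. -/
abbrev RMonomialBurnside (C Γ : Type) [CommGroup C] [Group Γ] : Type u :=
  R ⊗[ℤ] monomialBurnside C Γ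

/-- The `R`-bilinear extension of the composition. -/
def compR (G H K C : Type) [Group G] [Group H] [Group K] [CommGroup C] :
    RMonomialBurnside R C (G × H) →ₗ[R] RMonomialBurnside R C (H × K) →ₗ[R]
      RMonomialBurnside R C (G × K) :=
  LinearMap.liftBaseChange R
    (LinearMap.baseChangeHom ℤ R (monomialBurnside C (H × K)) (monomialBurnside C (G × K)) ∘ₗ
      compM G H K C)

theorem compR_tmul {G H K C : Type} [Group G] [Group H] [Group K] [CommGroup C] (r s : R)
    (a : monomialBurnside C (G × H)) (b : monomialBurnside C (H × K)) :
    compR R G H K C (r ⊗ₜ a) (s ⊗ₜ b) = (r * s) ⊗ₜ compM G H K C a b := by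
  simp [compR, TensorProduct.smul_tmul']

theorem compR_assoc {G H K L C : Type} [Group G] [Group H] [Group K] [Group L] [CommGroup C]
    (a : RMonomialBurnside R C (G × H)) (b : RMonomialBurnside R C (H × K))
    (c : RMonomialBurnside R C (K × L)) :
    compR R G K L C (compR R G H K C a b) c = compR R G H L C a (compR R H K L C b c) := by
  induction a using TensorProduct.induction_on with
  | zero => simp
  | add x y h h' => simp [h, h']
  | tmul r x =>
  induction b using TensorProduct.induction_on with
  | zero => simp
  | add x y h h' => simp [h, h']
  | tmul s y =>
  induction c using TensorProduct.induction_on with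
  | zero => simp
  | add x y h h' => simp [h, h']
  | tmul t z => simp only [compR_tmul, compM_assoc, mul_assoc]

/-- The class of the transitive fibred set `C_δ Γ/D` in `R B_C^1(Γ)`. -/
def transElt {C Γ : Type} [CommGroup C] [Group Γ] [Finite Γ] [Finite C] (D : Subgroup Γ)
    (δ : D →* C) : RMonomialBurnside R C Γ :=
  1 ⊗ₜ transM D δ

end Coefficients

/-! ### The category of finite groups and fibred bisets -/

/-- Objects of the category `𝒫` attached to `R B_C^1`: the finite groups. -/
structure FibObj (R : Type u) (C : Type) where
  /-- the underlying group -/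
  (carrier : Type)
  [group : Group carrier]
  [finite : Finite carrier]

attribute [instance] FibObj.group FibObj.finite

/-- A finite group as an object of the category. -/
abbrev FibObj.of (R : Type u) (C : Type) (G : Type) [Group G] [Finite G] : FibObj R C :=
  ⟨G⟩

section Category

variable (R : Type u) [CommRing R] (C : Type) [CommGroup C] [Finite C]

/-- The morphisms from `X` to `Y` are the elements of `R B_C^1(Y × X)`; the identity of `X` is
the class of `C(X × X)/Δ(X)`. -/
instance fibCategory : Category (FibObj R C) where
  Hom X Y := RMonomialBurnside R C (Y.carrier × X.carrier)
  id X := transElt R (graph (MonoidHom.id X.carrier)) 1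
  comp {X Y Z} f g := compR R Z.carrier Y.carrier X.carrier C g f
  id_comp {X Y} f := by
    induction f using TensorProduct.induction_on with
    | zero => simp
    | add x y h h' => rw [map_add, LinearMap.add_apply, h, h']
    | tmul r x => rw [transElt, compR_tmul, mul_one, compM_id_right]
  comp_id {X Y} f := by
    induction f using TensorProduct.induction_on with
    | zero => simp
    | add x y h h' => rw [map_add, h, h']
    | tmul r x => rw [transElt, compR_tmul, one_mul, compM_id_left]
  assoc f g h := (compR_assoc R h g f).symm

variable {R C}

/-- An element of `R B_C^1(H × G)` as a morphism from `G` to `H`. -/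
abbrev asHom {G H : Type} [Group G] [Finite G] [Group H] [Finite H]
    (a : RMonomialBurnside R C (H × G)) : FibObj.of R C G ⟶ FibObj.of R C H := a

instance (X Y : FibObj R C) : AddCommGroup (X ⟶ Y) :=
  inferInstanceAs (AddCommGroup (RMonomialBurnside R C (Y.carrier × X.carrier)))

instance (X Y : FibObj R C) : Module R (X ⟶ Y) :=
  inferInstanceAs (Module R (RMonomialBurnside R C (Y.carrier × X.carrier)))

theorem comp_eq {X Y Z : FibObj R C} (f : X ⟶ Y) (g : Y ⟶ Z) :
    f ≫ g = compR R Z.carrier Y.carrier X.carrier C g f := rfl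

instance : Preadditive (FibObj R C) where
  add_comp X Y Z f f' g := by
    simp only [comp_eq]
    exact map_add _ _ _
  comp_add X Y Z f g g' := by
    simp only [comp_eq]
    exact LinearMap.map_add₂ _ _ _ _

instance : Linear R (FibObj R C) where
  smul_comp X Y Z r f g := by
    simp only [comp_eq]
    exact map_smul _ _ _
  comp_smul X Y Z f r g := by
    simp only [comp_eq]
    exact LinearMap.map_smul₂ _ _ _ _

end Category

/-! ### The quotient algebra, simple functors and their minimal groups -/

section Modules

variable (R : Type u) [CommRing R] (C : Type) [CommGroup C] [Finite C]

variable {R C} in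
/-- The submodule `I(X)` of `R B_C^1(X × X)` generated by the elements which factor through a
group of order smaller than `|X|`. -/
def factorSubmodule (X : FibObj R C) : Submodule R (X ⟶ X) :=
  Submodule.span R {f | ∃ (K : FibObj R C) (a : K ⟶ X) (b : X ⟶ K),
    Nat.card K.carrier < Nat.card X.carrier ∧ f = b ≫ a}

variable {R C} in
theorem comp_mem_factorSubmodule {X : FibObj R C} (f g h : X ⟶ X)
    (hg : g ∈ factorSubmodule X) : f ≫ g ≫ h ∈ factorSubmodule X := by
  induction hg using Submodule.span_induction with
  | zero => simp
  | add x y hx hy h1 h2 =>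
    rw [Preadditive.add_comp, Preadditive.comp_add]
    exact add_mem h1 h2
  | smul r x hx h1 =>
    rw [Linear.smul_comp, Linear.comp_smul]
    exact Submodule.smul_mem _ _ h1
  | mem x hx =>
    obtain ⟨K, a, b, hK, rfl⟩ := hx
    exact Submodule.subset_span ⟨K, a ≫ h, f ≫ b, hK, by simp⟩

variable {R C} in
/-- `I(X)` as a two-sided ideal of the ring `R B_C^1(X × X)`, whose product is the
composition `∘`. -/
def factorIdeal (X : FibObj R C) : TwoSidedIdeal (End X) :=
  TwoSidedIdeal.mk' {f : End X | f ∈ factorSubmodule X}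
    (zero_mem (factorSubmodule X))
    (fun hx hy => (factorSubmodule X).add_mem hx hy)
    (fun hx => (factorSubmodule X).neg_mem hx)
    (fun {x y} hy => by
      have := comp_mem_factorSubmodule (𝟙 X) y x hy
      rwa [Category.id_comp] at this)
    (fun {x y} hx => by
      have := comp_mem_factorSubmodule y x (𝟙 X) hx
      rwa [Category.comp_id] at this)

variable {R C} in
/-- The quotient ring of `R B_C^1(X × X)` by `I(X)`. -/
abbrev Hat (X : FibObj R C) : Type u := (factorIdeal X).ringCon.Quotient

variable {R C} in
/-- The class in the quotient ring of an element of `R B_C^1(X × X)`. -/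
def Hat.mk {X : FibObj R C} : End X →+* Hat X := (factorIdeal X).ringCon.mk'

/-- A simple fibred biset functor: a simple `R`-linear functor to `R`-modules.
(Every subfunctor of an `R`-linear functor is `R`-linear, so simplicity may be tested in the
category of all functors.) -/
structure SimpleFunctor where
  /-- the underlying functor -/
  (functor : FibObj R C ⥤ ModuleCat.{u} R)
  [additive : functor.Additive]
  [linear : functor.Linear R]
  [simple : Simple functor]

variable {R C} in
/-- `X` is a minimal group of `S`: the value of `S` at `X` is nonzero, and its value at any group
of smaller order is zero. -/
def SimpleFunctor.IsMinimal (S : SimpleFunctor R C) (X : FibObj R C) : Prop :=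
  Nontrivial (S.functor.obj X) ∧
    ∀ Y : FibObj R C, Nat.card Y.carrier < Nat.card X.carrier → Subsingleton (S.functor.obj Y)

/-- A couple `(H, V)`: a finite group `H` whose quotient ring is nonzero, and a simple module `V`
over that ring. -/
structure Seed where
  /-- the group -/
  (grp : FibObj R C)
  [hat_ne : Nontrivial (Hat grp)]
  /-- the module -/
  (V : Type u)
  [addCommGroup : AddCommGroup V]
  [module : Module (Hat grp) V]
  [simple : IsSimpleModule (Hat grp) V]

attribute [instance] Seed.addCommGroup Seed.module

variable {R C} in
/-- The morphism of the category given by a group isomorphism: the class of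
`C(H × G)/{(φ g, g) | g ∈ G}`. -/
def isoHom {X Y : FibObj R C} (φ : X.carrier ≃* Y.carrier) : X ⟶ Y :=
  transElt R (graph φ.toMonoidHom) 1

variable {R C} in
/-- Two couples are equivalent if there is an isomorphism of the groups along which the modules
become isomorphic. -/
def Seed.Equivalent (s t : Seed R C) : Prop :=
  ∃ (φ : s.grp.carrier ≃* t.grp.carrier) (e : s.V ≃+ t.V),
    ∀ (f : s.grp ⟶ s.grp) (v : s.V),
      e (Hat.mk (X := s.grp) f • v) =
        Hat.mk (X := t.grp) (isoHom φ.symm ≫ f ≫ isoHom φ) • e v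

variable {R C} in
/-- The couple `s = (H, V)` is attached to `S`: the group `H` is a minimal group of `S`, and `V`
is isomorphic to `S(H)` as a module. -/
def SimpleFunctor.Attached (S : SimpleFunctor R C) (s : Seed R C) : Prop :=
  S.IsMinimal s.grp ∧ ∃ e : s.V ≃+ S.functor.obj s.grp,
    ∀ (f : s.grp ⟶ s.grp) (v : s.V), e (Hat.mk (X := s.grp) f • v) = (S.functor.map f).hom (e v)

/-- The conjectural parametrization of the simple fibred biset functors: there is a bijection from
their isomorphism classes to the equivalence classes of couples `(H, V)`, which sends the class
of `S` to the class of `(H, S(H))` for every minimal group `H` of `S`. -/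
def Parametrization : Prop :=
  ∃ Φ : Quot (fun S T : SimpleFunctor R C => Nonempty (S.functor ≅ T.functor)) ≃
      Quot (Seed.Equivalent (R := R) (C := C)),
    ∀ (S : SimpleFunctor R C) (s : Seed R C), S.Attached s → Φ (Quot.mk _ S) = Quot.mk _ s

end Modules

/-! ### The opposite of a subcharacter, and the subgroup of the example -/

section Example

variable {G H C : Type} [Group G] [Group H] [CommGroup C]

/-- `D° = {(h, g) | (g, h) ∈ D}`. -/
def opSubgroup (D : Subgroup (G × H)) : Subgroup (H × G) :=
  D.comap (MulEquiv.prodComm : H × G ≃* G × H).toMonoidHom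

/-- `δ°(h, g) = δ(g, h)⁻¹`. -/
def opHom {D : Subgroup (G × H)} (δ : D →* C) : opSubgroup D →* C where
  toFun p := (δ ⟨(p.1.2, p.1.1), p.2⟩)⁻¹
  map_one' := inv_eq_one.2 (map_one δ)
  map_mul' p q := by
    rw [← mul_inv, ← map_mul]
    rfl

/-- The subgroup `⟨(x, a), (y, b)⟩` of `Q₈ × D₈`, where `Q₈` is generated by `x = a 1` and
`y = xa 0`, and `D₈` is generated by the rotation `a = r 1` and the reflection `b = sr 0`. -/
def exampleD : Subgroup (QuaternionGroup 2 × DihedralGroup 4) :=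
  Subgroup.closure {(QuaternionGroup.a 1, DihedralGroup.r 1),
    (QuaternionGroup.xa 0, DihedralGroup.sr 0)}

/-- The generator `(x, a)`. -/
def genXA : exampleD :=
  ⟨(QuaternionGroup.a 1, DihedralGroup.r 1), Subgroup.subset_closure (by simp)⟩

/-- The generator `(y, b)`. -/
def genYB : exampleD :=
  ⟨(QuaternionGroup.xa 0, DihedralGroup.sr 0), Subgroup.subset_closure (by simp)⟩

/-- `X = C_δ(Q₈ × D₈)/D`, as a morphism from `D₈` to `Q₈`. -/
def exampleX (R : Type u) [CommRing R] [Finite C] (δ : exampleD →* C) :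
    FibObj.of R C (DihedralGroup 4) ⟶ FibObj.of R C (QuaternionGroup 2) :=
  asHom (transElt R exampleD δ)

/-- `X° = C_δ°(D₈ × Q₈)/D°`, as a morphism from `Q₈` to `D₈`. -/
def exampleXop (R : Type u) [CommRing R] [Finite C] (δ : exampleD →* C) :
    FibObj.of R C (QuaternionGroup 2) ⟶ FibObj.of R C (DihedralGroup 4) :=
  asHom (transElt R (opSubgroup exampleD) (opHom δ))

/-- `W = X ∘ X°`, an element of `R B_C^1(Q₈ × Q₈)`. -/
def exampleW (R : Type u) [CommRing R] [Finite C] (δ : exampleD →* C) :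
    End (FibObj.of R C (QuaternionGroup 2)) :=
  exampleXop R δ ≫ exampleX R δ

end Example

end FibredBurnside

end

open CategoryTheory FibredBurnside

/-! A simple module `V` over `End A` produces a simple functor: the image of `Hom(A, K) ⊗ V` in
`Hom(Hom(K, A), V)` under `f ⊗ v ↦ (g ↦ (g ∘ f) v)`. Every nonzero element of a value generates the
whole functor (`exists_map_eq`), and the value at `K` vanishes exactly when all endomorphisms of `A`
through `K` kill `V`. To make Q₈ and D₈ minimal groups of one simple functor it therefore suffices
to have an idempotent `W` of `End(Q₈)` that factors through D₈ and lies outside `I(Q₈)`: a maximal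
left ideal `M` containing `I(Q₈)` and `1 - W` gives `V = End(Q₈)/M`, killed by `I(Q₈)` but not by
`W` (`exists_simpleFunctor`). Both values are simple modules, and equivalent couples have isomorphic
groups, so the parametrization would force Q₈ ≅ D₈ (`not_parametrization`).

The idempotent is `W = X ∘ X°`. Since `D` projects onto both factors, `X ∘ X°` is transitive; its
stabilizer is the relation `D_δ` composed with its inverse, which contains the diagonal and is
unchanged by composition with itself (`compSet_op_idempotent`).

That `W` lies outside `I(Q₈)` is detected by the multiplicity of the transitive set `W`, a linear
form with value 1 on `W` over any field. Suppose an orbit `[t, y]` in a composition through `K` has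
the stabilizer of `W`, and let `E` be the stabilizer of `t`. Then `E` projects onto Q₈, and its
elements with trivial `K`-component lie over `1` or `z = x²`, but `(z, 1, 1)` is excluded because
`δ(z, 1) = c² ≠ 1`. This forces `|K| ≥ 8` (`card_le_card_of_stabilizer`). If no `(z, 1, d)` is in
`E`, choosing partners embeds Q₈ in `K`. Otherwise partners only separate cosets of `⟨z⟩`; but `z =
[x, y]`, and the commutator of lifts of `x` and `y` has trivial `C`-component since `C` is abelian.
Its `K`-component `κ` is then nontrivial, and multiplication by `κ` recovers the missing factor 2.
-/

noncomputable section

universe u u₁ w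

/-! ### The simple functor generated by a simple module over an endomorphism ring -/

section GeneratedFunctor

variable {k : Type w} [Field k] {𝒞 : Type u₁} [Category.{w} 𝒞] [Preadditive 𝒞] [Linear k 𝒞]
  (A : 𝒞) (V : Type w) [AddCommGroup V] [Module k V] [Module (End A) V]
  [IsScalarTower k (End A) V]

variable (k) in
/-- The linear map `g ↦ (g ∘ f) • v` on `Hom(K, A)`, where `f : A ⟶ K`. -/
def evalMap {K : 𝒞} (f : A ⟶ K) (v : V) : (K ⟶ A) →ₗ[k] V where
  toFun g := End.of (f ≫ g) • v
  map_add' g g' := by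
    rw [Preadditive.comp_add]
    exact add_smul (R := End A) _ _ v
  map_smul' r g := by
    rw [Linear.comp_smul]
    exact smul_assoc (N := End A) r _ v

variable (k) in
/-- The space spanned by the maps `g ↦ (g ∘ f) • v`. -/
def generatedSubmodule (K : 𝒞) : Submodule k ((K ⟶ A) →ₗ[k] V) :=
  Submodule.span k {φ | ∃ (f : A ⟶ K) (v : V), φ = evalMap k A V f v}

variable {A V}

theorem evalMap_apply {K : 𝒞} (f : A ⟶ K) (v : V) (g : K ⟶ A) :
    evalMap k A V f v g = End.of (f ≫ g) • v := rfl

theorem evalMap_comp_leftComp {K L : 𝒞} (f : A ⟶ K) (v : V) (h : K ⟶ L) :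
    evalMap k A V f v ∘ₗ Linear.leftComp k A h = evalMap k A V (f ≫ h) v := by
  ext g
  simp [evalMap_apply]

theorem evalMap_mem {K : 𝒞} (f : A ⟶ K) (v : V) :
    evalMap k A V f v ∈ generatedSubmodule k A V K :=
  Submodule.subset_span ⟨f, v, rfl⟩

theorem comp_leftComp_mem {K L : 𝒞} (h : K ⟶ L) {φ : (K ⟶ A) →ₗ[k] V}
    (hφ : φ ∈ generatedSubmodule k A V K) :
    φ ∘ₗ Linear.leftComp k A h ∈ generatedSubmodule k A V L := by
  induction hφ using Submodule.span_induction with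
  | zero => simp
  | add x y _ _ hx hy =>
    rw [LinearMap.add_comp]
    exact add_mem hx hy
  | smul r x _ hx =>
    rw [LinearMap.smul_comp]
    exact Submodule.smul_mem _ _ hx
  | mem x hx =>
    obtain ⟨f, v, rfl⟩ := hx
    rw [evalMap_comp_leftComp]
    exact evalMap_mem _ _

variable (k A V) in
/-- The functor `K ↦ ⟨g ↦ (g ∘ f) • v⟩ ⊆ Hom(Hom(K, A), V)`. -/
def generatedFunctor : 𝒞 ⥤ ModuleCat.{w} k where
  obj K := ModuleCat.of k (generatedSubmodule k A V K)
  map h := ModuleCat.ofHom <| LinearMap.restrict (LinearMap.lcomp k V (Linear.leftComp k A h))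
    fun _ hφ => comp_leftComp_mem h hφ
  map_id K := by
    refine ModuleCat.hom_ext (LinearMap.ext fun φ => Subtype.ext (LinearMap.ext fun g => ?_))
    exact congrArg φ.1 (Category.id_comp g)
  map_comp h h' := by
    refine ModuleCat.hom_ext (LinearMap.ext fun φ => Subtype.ext (LinearMap.ext fun g => ?_))
    exact congrArg φ.1 (Category.assoc _ _ g)

theorem generatedFunctor_ext {K : 𝒞} {φ ψ : (generatedFunctor k A V).obj K}
    (h : ∀ g, φ.1 g = ψ.1 g) : φ = ψ :=
  Subtype.ext (LinearMap.ext h)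

instance : (generatedFunctor k A V).Additive where
  map_add {K L h h'} := by
    refine ModuleCat.hom_ext (LinearMap.ext fun φ => ?_)
    refine generatedFunctor_ext fun g => ?_
    change φ.1 ((h + h') ≫ g) = φ.1 (h ≫ g) + φ.1 (h' ≫ g)
    rw [Preadditive.add_comp, map_add]

instance : (generatedFunctor k A V).Linear k where
  map_smul {K L} h r := by
    refine ModuleCat.hom_ext (LinearMap.ext fun φ => ?_)
    refine generatedFunctor_ext fun g => ?_
    change φ.1 ((r • h) ≫ g) = r • φ.1 (h ≫ g)
    rw [Linear.smul_comp, map_smul]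

/-- Every nonzero element of a value generates the whole functor. -/
theorem exists_map_eq [IsSimpleModule (End A) V] {K L : 𝒞}
    {φ : (generatedFunctor k A V).obj K} (hφ : φ ≠ 0) (ψ : (generatedFunctor k A V).obj L) :
    ∃ h : K ⟶ L, ((generatedFunctor k A V).map h).hom φ = ψ := by
  obtain ⟨g, hg⟩ : ∃ g, φ.1 g ≠ 0 := by
    by_contra! hcon
    exact hφ (generatedFunctor_ext hcon)
  -- Each functional in the value commutes with `End A`: the generators do, and `k` acts on `V`
  -- through central elements of `End A`.
  have hφg : ∀ e : End A, φ.1 (g ≫ e) = e • φ.1 g := by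
    have : ∀ φ ∈ generatedSubmodule k A V K, ∀ e : End A, φ (g ≫ e) = e • φ g := by
      intro φ hφ e
      induction hφ using Submodule.span_induction with
      | zero => simp
      | add x y _ _ hx hy => rw [LinearMap.add_apply, LinearMap.add_apply, hx, hy, smul_add]
      | smul r x _ hx =>
        rw [LinearMap.smul_apply, LinearMap.smul_apply, hx]
        have h1 : ∀ v : V, r • v = (r • (1 : End A)) • v := fun v => by
          rw [smul_assoc, one_smul]
        rw [h1, h1, smul_smul, smul_smul, smul_mul_assoc, one_mul, mul_smul_comm, mul_one]
      | mem x hx =>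
        obtain ⟨f, v, rfl⟩ := hx
        rw [evalMap_apply, evalMap_apply, smul_smul]
        congr 1
        exact (Category.assoc f g e).symm
    exact this _ φ.2
  obtain ⟨ψ, hψ⟩ := ψ
  suffices ∃ h : K ⟶ L, ∀ g' : L ⟶ A, φ.1 (h ≫ g') = ψ g' by
    obtain ⟨h, hh⟩ := this
    exact ⟨h, generatedFunctor_ext hh⟩
  -- The elements reachable from `φ` are closed under sums and multiples because `φ` is linear in
  -- the arrow, so only generators matter.
  induction hψ using Submodule.span_induction with
  | zero => exact ⟨0, fun g' => by simp⟩
  | add x y _ _ hx hy =>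
    obtain ⟨h, hx⟩ := hx
    obtain ⟨h', hy⟩ := hy
    exact ⟨h + h', fun g' => by
      rw [Preadditive.add_comp, map_add, hx, hy, LinearMap.add_apply]⟩
  | smul r x _ hx =>
    obtain ⟨h, hx⟩ := hx
    exact ⟨r • h, fun g' => by rw [Linear.smul_comp, map_smul, hx, LinearMap.smul_apply]⟩
  | mem x hx =>
    obtain ⟨f, v, rfl⟩ := hx
    -- In a simple module some `e` carries the nonzero vector `φ.1 g` to `v`; the arrow `K → A → A →
    -- L` through `g`, `e`, `f` then carries `φ` to the generator given by `f` and `v`.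
    obtain ⟨e, he⟩ := IsSimpleModule.toSpanSingleton_surjective (End A) hg v
    refine ⟨g ≫ e.asHom ≫ f, fun g' => ?_⟩
    have h2 := hφg (End.of (f ≫ g') * e)
    rw [mul_smul] at h2
    rw [evalMap_apply, ← he, Category.assoc, Category.assoc]
    exact h2

theorem generatedFunctor_obj_subsingleton {K : 𝒞}
    (h : ∀ (f : A ⟶ K) (g : K ⟶ A) (v : V), End.of (f ≫ g) • v = 0) :
    Subsingleton ((generatedFunctor k A V).obj K) := by
  refine subsingleton_of_forall_eq 0 fun ⟨φ, hφ⟩ => generatedFunctor_ext fun g => ?_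
  change φ g = 0
  induction hφ using Submodule.span_induction with
  | zero => simp
  | add x y _ _ hx hy => rw [LinearMap.add_apply, hx, hy, add_zero]
  | smul r x _ hx => rw [LinearMap.smul_apply, hx, smul_zero]
  | mem x hx =>
    obtain ⟨f, v, rfl⟩ := hx
    exact h f g v

theorem generatedFunctor_obj_nontrivial {K : 𝒞} (f : A ⟶ K) (g : K ⟶ A) (v : V)
    (h : End.of (f ≫ g) • v ≠ 0) : Nontrivial ((generatedFunctor k A V).obj K) :=
  ⟨⟨⟨evalMap k A V f v, evalMap_mem f v⟩, 0, fun h0 => h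
    (congrArg (fun φ : (generatedFunctor k A V).obj K => φ.1 g) h0)⟩⟩

/-- The image of a nonzero monomorphism contains a nonzero element of some value, and by
`exists_map_eq` this element reaches every element of every value. The functor itself is nonzero
because its value at `A` is. -/
instance [IsSimpleModule (End A) V] : Simple (generatedFunctor k A V) where
  mono_isIso_iff_nonzero {Y} f _ := by
    have hinj : ∀ K, Function.Injective (f.app K).hom := fun K =>
      (ModuleCat.mono_iff_injective (f.app K)).1 ((NatTrans.mono_iff_mono_app f).1 inferInstance K)
    constructor
    · rintro hiso rfl
      have := IsSimpleModule.nontrivial (End A) V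
      obtain ⟨v, hv⟩ := exists_ne (0 : V)
      obtain ⟨a, b, hab⟩ := generatedFunctor_obj_nontrivial (k := k) (𝟙 A) (𝟙 A) v (by
        rw [Category.comp_id]
        exact (one_smul (End A) v).symm ▸ hv)
      have h0 : ∀ a : (generatedFunctor k A V).obj A, a = 0 := fun a => by
        have := (ModuleCat.epi_iff_surjective ((0 : Y ⟶ generatedFunctor k A V).app A)).1
          inferInstance a
        obtain ⟨y, rfl⟩ := this
        rfl
      exact hab ((h0 a).trans (h0 b).symm)
    · intro hf
      obtain ⟨K, y, hy⟩ : ∃ K, ∃ y : Y.obj K, (f.app K).hom y ≠ 0 := by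
        by_contra! hcon
        exact hf (by
          ext K y
          exact hcon K y)
      have : ∀ L, IsIso (f.app L) := fun L => by
        have hsurj : Function.Surjective (f.app L).hom := fun ψ => by
          obtain ⟨h, hh⟩ := exists_map_eq hy ψ
          refine ⟨(Y.map h).hom y, ?_⟩
          rw [← hh]
          exact congrArg (fun t => t.hom y) (f.naturality h)
        exact (ConcreteCategory.isIso_iff_bijective (f.app L)).2 ⟨hinj L, hsurj⟩
      exact NatIso.isIso_of_isIso_app f

end GeneratedFunctor

/-! ### Simple functors from idempotents, and couples attached to minimal groups -/

section Seeds

variable {k : Type u} [Field k] {C : Type} [CommGroup C] [Finite C]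

theorem hatMk_eq_zero_iff {X : FibObj k C} {f : End X} :
    Hat.mk f = 0 ↔ f ∈ factorSubmodule X := by
  refine (RingCon.eq _).trans ((TwoSidedIdeal.mem_iff _ _).symm.trans ?_)
  rw [factorIdeal, TwoSidedIdeal.mem_mk']
  rfl

/-- An idempotent with nonzero class in the quotient ring lies outside some maximal left ideal
which contains the ideal of the morphisms factoring through smaller groups. -/
theorem exists_maximal_left_ideal {X : FibObj k C} {W : End X} (hW : IsIdempotentElem W)
    (hne : Hat.mk W ≠ 0) :
    ∃ M : Submodule (End X) (End X), IsCoatom M ∧ (∀ f ∈ factorSubmodule X, (f : End X) ∈ M) ∧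
      W ∉ M := by
  -- The left annihilator of `W` modulo `I(X)`: it contains `I(X)` and `1 - W`, and it is proper
  -- because `W` is not in `I(X)`.
  let I : Submodule (End X) (End X) :=
    { carrier := {f | f * W ∈ factorSubmodule X}
      zero_mem' := by
        simp only [Set.mem_ofPred_eq, zero_mul]
        exact zero_mem (factorSubmodule X)
      add_mem' := fun {f g} hf hg => by
        simp only [Set.mem_ofPred_eq, add_mul] at *
        exact add_mem (S := Submodule k (X ⟶ X)) hf hg
      smul_mem' := fun r f hf => by
        simp only [Set.mem_ofPred_eq, smul_eq_mul, mul_assoc] at *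
        rw [← hatMk_eq_zero_iff] at hf ⊢
        rw [map_mul, hf, mul_zero] }
  have hI : I ≠ ⊤ := fun h => by
    have h1 : (1 : End X) ∈ I := h ▸ Submodule.mem_top
    change 1 * W ∈ factorSubmodule X at h1
    rw [one_mul] at h1
    exact hne (hatMk_eq_zero_iff.2 h1)
  obtain ⟨M, hM, hIM⟩ := Ideal.exists_le_maximal I hI
  refine ⟨M, Ideal.isMaximal_def.1 hM, fun f hf => hIM ?_, fun hWM => hM.ne_top ?_⟩
  · change End.of (f) * W ∈ factorSubmodule X
    rw [← hatMk_eq_zero_iff, map_mul, hatMk_eq_zero_iff.2 hf, zero_mul]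
  -- Since `(1 - W) W = 0`, the ideal contains `1 - W`; with `W` it would contain `1`.
  · have h1 : 1 - W ∈ M := hIM (by
      change (1 - W) * W ∈ factorSubmodule X
      rw [sub_mul, one_mul, hW.eq, sub_self]
      exact zero_mem (factorSubmodule X))
    exact (Ideal.eq_top_iff_one M).2 (by simpa using M.add_mem h1 hWM)

/-- An idempotent of the endomorphism ring of `X` which factors through a group `Y` of the same
order and has nonzero class in the quotient ring gives a simple functor with minimal groups `X`
and `Y`. -/
theorem exists_simpleFunctor {X Y : FibObj k C}
    (hcard : Nat.card Y.carrier = Nat.card X.carrier) (b : X ⟶ Y) (a : Y ⟶ X)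
    (hW : IsIdempotentElem (End.of (b ≫ a))) (hne : Hat.mk (End.of (b ≫ a)) ≠ 0) :
    ∃ S : SimpleFunctor k C, S.IsMinimal X ∧ S.IsMinimal Y ∧
      ∀ (Z : FibObj k C) (φ ψ : S.functor.obj Z), φ ≠ 0 →
        ∃ h : Z ⟶ Z, (S.functor.map h).hom φ = ψ := by
  obtain ⟨M, hM, hIM, hWM⟩ := exists_maximal_left_ideal hW hne
  have : IsSimpleModule (End X) (End X ⧸ M) := isSimpleModule_iff_isCoatom.2 hM
  let S : SimpleFunctor k C := { functor := generatedFunctor k X (End X ⧸ M) }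
  have hsmall : ∀ K : FibObj k C, Nat.card K.carrier < Nat.card X.carrier →
      Subsingleton (S.functor.obj K) := fun K hK => by
    refine generatedFunctor_obj_subsingleton fun f g v => ?_
    induction v using Submodule.Quotient.induction_on with | _ e =>
    -- Precomposing with `e` still gives an endomorphism through the smaller group `K`, hence an
    -- element of `I(X) ⊆ M`.
    refine (Submodule.Quotient.mk_eq_zero M).2 (hIM _ ?_)
    have h1 : End.of (f ≫ g) * e = e.asHom ≫ f ≫ g := rfl
    change End.of (f ≫ g) * e ∈ factorSubmodule X
    rw [h1, ← Category.assoc]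
    exact Submodule.subset_span ⟨K, g, _, hK, rfl⟩
  -- The class of `1` is the test vector. It serves at `X` with `W` written as `𝟙 X ≫ W`, and at `Y`
  -- with `W = b ≫ a`.
  have hnt : ∀ {K : FibObj k C} (f : X ⟶ K) (g : K ⟶ X), End.of (f ≫ g) ∉ M →
      Nontrivial (S.functor.obj K) := fun f g h =>
    generatedFunctor_obj_nontrivial f g (Submodule.Quotient.mk (p := M) 1) fun h0 => by
      have := (Submodule.Quotient.mk_eq_zero M).1 h0
      exact h ((mul_one (End.of (f ≫ g))) ▸ this)
  refine ⟨S, ⟨hnt (𝟙 X) (b ≫ a) ?_, hsmall⟩, ⟨hnt b a hWM, fun K hK => hsmall K (hcard ▸ hK)⟩,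
    fun Z φ ψ hφ => exists_map_eq hφ ψ⟩
  rwa [Category.id_comp]

/-- The value of a functor at one of its minimal groups is a seed attached to it, provided it is a
simple module. -/
theorem exists_attached_seed {S : SimpleFunctor k C} {X : FibObj k C} (hX : S.IsMinimal X)
    (hS : ∀ φ ψ : S.functor.obj X, φ ≠ 0 → ∃ h : X ⟶ X, (S.functor.map h).hom φ = ψ) :
    ∃ s : Seed k C, s.grp = X ∧ S.Attached s := by
  have := S.additive
  have := S.linear
  let ρ : End X →+* Module.End k (S.functor.obj X) :=
    { toFun := fun f => (S.functor.map f).hom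
      map_one' := congrArg ModuleCat.Hom.hom (S.functor.map_id X)
      -- The product `f * g` of `End X` is `g ≫ f`.
      map_mul' := fun f g => congrArg ModuleCat.Hom.hom (S.functor.map_comp g f)
      map_zero' := congrArg ModuleCat.Hom.hom (S.functor.map_zero X X)
      map_add' := fun f g => congrArg ModuleCat.Hom.hom (S.functor.map_add (f := f) (g := g)) }
  -- An endomorphism through a smaller group acts through a zero value of `S`, so the action
  -- descends to `Hat X`.
  have hker : ∀ f ∈ factorSubmodule X, ρ f = 0 := fun f hf => by
    induction hf using Submodule.span_induction with
    | zero => exact map_zero ρ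
    | add x y _ _ hx hy => exact (map_add ρ x y).trans (by rw [hx, hy, add_zero])
    | smul r x _ hx =>
      have : ρ (r • x) = r • ρ x := congrArg ModuleCat.Hom.hom (S.functor.map_smul r x)
      exact this.trans (by rw [hx, smul_zero])
    | mem x hx =>
      obtain ⟨K, a, b, hK, rfl⟩ := hx
      refine LinearMap.ext fun v => ?_
      have h1 : ρ (b ≫ a) v = (S.functor.map a).hom ((S.functor.map b).hom v) :=
        congrArg (fun t => t.hom v) (S.functor.map_comp b a)
      have := hX.2 K hK
      rw [h1, Subsingleton.elim ((S.functor.map b).hom v) 0, map_zero]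
      rfl
  let σ : Hat X →+* Module.End k (S.functor.obj X) := (factorIdeal X).ringCon.lift ρ (by
    intro f g hfg
    have h1 : Hat.mk (f - g) = 0 := by
      rw [map_sub, sub_eq_zero]
      exact (RingCon.eq _).2 hfg
    have h2 := hker _ (hatMk_eq_zero_iff.1 h1)
    exact sub_eq_zero.1 ((map_sub ρ f g).symm.trans h2))
  let : Module (Hat X) (S.functor.obj X) := Module.compHom _ σ
  have hsmul : ∀ (f : X ⟶ X) (v : S.functor.obj X),
      Hat.mk (X := X) f • v = (S.functor.map f).hom v := fun _ _ => rfl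
  have := hX.1
  have : Nontrivial (Hat X) := Module.nontrivial (Hat X) (S.functor.obj X)
  have : IsSimpleModule (Hat X) (S.functor.obj X) :=
    isSimpleModule_iff_toSpanSingleton_surjective.2 ⟨inferInstance, fun φ hφ ψ => by
      obtain ⟨h, hh⟩ := hS φ ψ hφ
      exact ⟨Hat.mk (X := X) h, hh⟩⟩
  exact ⟨{ grp := X, V := S.functor.obj X }, rfl, hX, AddEquiv.refl _, hsmul⟩

/-- The parametrization fails if some simple functor whose values are simple modules has two
nonisomorphic minimal groups. -/
theorem not_parametrization {S : SimpleFunctor k C} {X Y : FibObj k C} (hX : S.IsMinimal X)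
    (hY : S.IsMinimal Y)
    (hS : ∀ (Z : FibObj k C) (φ ψ : S.functor.obj Z), φ ≠ 0 →
      ∃ h : Z ⟶ Z, (S.functor.map h).hom φ = ψ)
    (hXY : IsEmpty (X.carrier ≃* Y.carrier)) : ¬ Parametrization k C := by
  rintro ⟨Φ, hΦ⟩
  obtain ⟨s, rfl, hs⟩ := exists_attached_seed hX (hS X)
  obtain ⟨t, rfl, ht⟩ := exists_attached_seed hY (hS Y)
  have hst := (hΦ S s hs).symm.trans (hΦ S t ht)
  -- The isomorphism class of the group is an invariant of the class of a couple; it separates `s`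
  -- from `t`.
  let P : Quot (Seed.Equivalent (R := k) (C := C)) → Prop :=
    Quot.lift (fun r => Nonempty (s.grp.carrier ≃* r.grp.carrier)) (by
      rintro r r' ⟨φ, -⟩
      exact propext ⟨fun ⟨e⟩ => ⟨e.trans φ⟩, fun ⟨e⟩ => ⟨e.trans φ.symm⟩⟩)
  have hP : P (Quot.mk _ s) := ⟨MulEquiv.refl _⟩
  rw [hst] at hP
  obtain ⟨e⟩ := hP
  exact hXY.false e

end Seeds

/-! ### Multiplicities of transitive sets -/

section Stabilizers

open MulAction

variable {Γ : Type} [Group Γ]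

theorem gsetIso_quotient_stabilizer {X : Type} [MulAction Γ X] (x : X)
    (h : ∀ y : X, ∃ g : Γ, g • x = y) : GSetIso Γ (Γ ⧸ stabilizer Γ x) X := by
  refine ⟨Equiv.ofBijective (ofQuotientStabilizer Γ x)
    ⟨injective_ofQuotientStabilizer Γ x, fun y => ?_⟩, fun g q => ofQuotientStabilizer_smul Γ x g q⟩
  obtain ⟨g, rfl⟩ := h y
  exact ⟨g, rfl⟩

theorem gsetIso_of_stabilizer_eq {X Y : Type} [MulAction Γ X] [MulAction Γ Y] (x : X) (y : Y)
    (hx : ∀ x' : X, ∃ g : Γ, g • x = x') (hy : ∀ y' : Y, ∃ g : Γ, g • y = y')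
    (h : stabilizer Γ x = stabilizer Γ y) : GSetIso Γ X Y :=
  (gsetIso_quotient_stabilizer x hx).symm.trans (h ▸ gsetIso_quotient_stabilizer y hy)

variable (S : Subgroup Γ)

/-- The orbit relation on the set of points with stabilizer `S`. -/
def stabSetoid (X : Type) [MulAction Γ X] : Setoid {x : X // stabilizer Γ x = S} where
  r x y := ∃ g : Γ, g • x.1 = y.1
  iseqv :=
    { refl := fun x => ⟨1, one_smul _ _⟩
      symm := by
        rintro x y ⟨g, hg⟩
        exact ⟨g⁻¹, by rw [← hg, inv_smul_smul]⟩
      trans := by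
        rintro x y z ⟨g, hg⟩ ⟨g', hg'⟩
        exact ⟨g' * g, by rw [mul_smul, hg, hg']⟩ }

/-- The set of orbits of `X` isomorphic to `Γ/S`. -/
def StabOrbits (X : Type) [MulAction Γ X] : Type := Quotient (stabSetoid S X)

instance (X : Type) [Finite X] [MulAction Γ X] : Finite (StabOrbits S X) :=
  inferInstanceAs (Finite (Quotient _))

variable {S}

theorem StabOrbits.card_congr {X Y : Type} [MulAction Γ X] [MulAction Γ Y] (h : GSetIso Γ X Y) :
    Nat.card (StabOrbits S X) = Nat.card (StabOrbits S Y) := by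
  obtain ⟨e, he⟩ := h
  have hs : ∀ x, stabilizer Γ x = S ↔ stabilizer Γ (e x) = S := fun x => by
    have : stabilizer Γ x = stabilizer Γ (e x) := by
      ext g
      rw [mem_stabilizer_iff, mem_stabilizer_iff, ← he, e.injective.eq_iff]
    rw [this]
  refine Nat.card_congr (Quotient.congr (e.subtypeEquiv hs) fun x y => exists_congr fun g => ?_)
  change _ ↔ g • e x.1 = e y.1
  rw [← he, e.injective.eq_iff]

theorem stabilizer_inl {X : Type} (Y : Type) [MulAction Γ X] [MulAction Γ Y] (x : X) :
    stabilizer Γ (Sum.inl x : X ⊕ Y) = stabilizer Γ x := by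
  ext g
  simp [mem_stabilizer_iff]

theorem stabilizer_inr (X : Type) {Y : Type} [MulAction Γ X] [MulAction Γ Y] (y : Y) :
    stabilizer Γ (Sum.inr y : X ⊕ Y) = stabilizer Γ y := by
  ext g
  simp [mem_stabilizer_iff]

theorem StabOrbits.card_sum (X Y : Type) [Finite X] [Finite Y] [MulAction Γ X] [MulAction Γ Y] :
    Nat.card (StabOrbits S (X ⊕ Y)) = Nat.card (StabOrbits S X) + Nat.card (StabOrbits S Y) := by
  rw [← Nat.card_sum]
  refine (Nat.card_congr (Equiv.ofBijective (Sum.elim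
    (Quotient.map' (fun x => ⟨Sum.inl x.1, (stabilizer_inl Y x.1).trans x.2⟩) ?_)
    (Quotient.map' (fun y => ⟨Sum.inr y.1, (stabilizer_inr X y.1).trans y.2⟩) ?_)) ⟨?_, ?_⟩)).symm
  · rintro x x' ⟨g, hg⟩
    exact ⟨g, congrArg Sum.inl hg⟩
  · rintro y y' ⟨g, hg⟩
    exact ⟨g, congrArg Sum.inr hg⟩
  · rintro (⟨⟨x⟩⟩ | ⟨⟨x⟩⟩) (⟨⟨y⟩⟩ | ⟨⟨y⟩⟩) h <;>
      obtain ⟨g, hg⟩ := Quotient.exact h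
    · exact congrArg Sum.inl (Quotient.sound ⟨g, Sum.inl.inj hg⟩)
    · exact absurd hg (by simp)
    · exact absurd hg (by simp)
    · exact congrArg Sum.inr (Quotient.sound ⟨g, Sum.inr.inj hg⟩)
  · rintro ⟨⟨x | y, h⟩⟩
    · exact ⟨Sum.inl (Quotient.mk _ ⟨x, (stabilizer_inl Y x).symm.trans h⟩), rfl⟩
    · exact ⟨Sum.inr (Quotient.mk _ ⟨y, (stabilizer_inr X y).symm.trans h⟩), rfl⟩

theorem StabOrbits.card_eq_zero {X : Type} [MulAction Γ X] (h : ∀ x : X, stabilizer Γ x ≠ S) :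
    Nat.card (StabOrbits S X) = 0 :=
  have : IsEmpty (StabOrbits S X) := ⟨fun q => Quotient.inductionOn q fun x => h x.1 x.2⟩
  Nat.card_of_isEmpty

theorem StabOrbits.card_eq_one {X : Type} [MulAction Γ X] (x : X) (hx : stabilizer Γ x = S)
    (h : ∀ y : X, ∃ g : Γ, g • x = y) : Nat.card (StabOrbits S X) = 1 := by
  refine Nat.card_eq_one_iff_unique.2 ⟨⟨?_⟩, ⟨Quotient.mk _ ⟨x, hx⟩⟩⟩
  have h' : ∀ p : StabOrbits S X, p = Quotient.mk _ ⟨x, hx⟩ := by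
    rintro ⟨y⟩
    obtain ⟨g, hg⟩ := h y.1
    exact Quotient.sound (s := stabSetoid S X) ⟨g⁻¹, by rw [← hg, inv_smul_smul]⟩
  exact fun a b => (h' a).trans (h' b).symm

variable (S)

/-- The multiplicity of `Γ/S` in a `Γ`-set, as an additive function on isomorphism classes. -/
def multCls : GSetClass Γ →+ ℤ where
  toFun := Quotient.lift (fun p => letI := p.2; (Nat.card (StabOrbits S (Fin p.1)) : ℤ))
    (fun p q h => by
      let := p.2; let := q.2
      exact congrArg Nat.cast (StabOrbits.card_congr (S := S) h))
  map_zero' := by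
    let := (Finite.equivFin Empty).symm.mulAction Γ
    refine (congrArg Nat.cast (StabOrbits.card_congr (S := S) (transport_iso (Γ := Γ) Empty))).trans
      ?_
    rw [StabOrbits.card_eq_zero fun x => x.elim]
    rfl
  map_add' a b := by
    obtain ⟨p⟩ := a
    obtain ⟨q⟩ := b
    let := p.2; let := q.2
    let := (Finite.equivFin (Fin p.1 ⊕ Fin q.1)).symm.mulAction Γ
    refine (congrArg Nat.cast (StabOrbits.card_congr (S := S)
      (transport_iso (Γ := Γ) (Fin p.1 ⊕ Fin q.1)))).trans ?_
    rw [StabOrbits.card_sum]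
    exact Nat.cast_add _ _

theorem multCls_cls (X : Type) [Finite X] [MulAction Γ X] :
    multCls S (cls Γ X) = Nat.card (StabOrbits S X) := by
  let := (Finite.equivFin X).symm.mulAction Γ
  exact congrArg Nat.cast (StabOrbits.card_congr (S := S) (transport_iso (Γ := Γ) X))

/-- The multiplicity of `Γ/S`, as an additive function on the Burnside group. -/
def multB : Burnside Γ →+ ℤ := Algebra.GrothendieckAddGroup.lift (multCls S)

theorem multB_bcls (X : Type) [Finite X] [MulAction Γ X] :
    multB S (bcls Γ X) = Nat.card (StabOrbits S X) :=
  (lift_of _ _).trans (multCls_cls S X)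

end Stabilizers

/-! ### Multiplicities as linear forms on the fibred Burnside group -/

section Multiplicity

open TensorProduct

variable (R : Type u) [CommRing R] {C Γ : Type} [CommGroup C] [Group Γ] (S : Subgroup (Γ × C))

/-- The coefficient of `(Γ × C)/S`, as a linear form on `R B_C^1(Γ)`. -/
def multR : RMonomialBurnside R C Γ →ₗ[R] R :=
  (AlgebraTensorModule.rid ℤ R R).toLinearMap ∘ₗ
    ((multB S).comp (monomialBurnside C Γ).subtype).toIntLinearMap.baseChange R

theorem multR_tmul (r : R) (x : monomialBurnside C Γ) :
    multR R S (r ⊗ₜ x) = (multB S x.1) • r := rfl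

end Multiplicity

/-! ### Stabilizers in a composition, and idempotence -/

section Composition

open MulAction

variable {G H K C : Type} [Group G] [Group H] [Group K] [CommGroup C]

/-- The displacement by `((g, l), c)` must come from some element of `H × C`. Thus the stabilizer of
an orbit is the relational composite of the two stabilizers, with `C`-components multiplied. -/
theorem orb_smul_mk_eq_iff {T Y : Type} [MulAction ((G × H) × C) T] [MulAction ((H × K) × C) Y]
    (t : T) (y : Y) (g : G) (l : K) (c : C) :
    (((g, l), c) : (G × K) × C) • Orb.mk G H K C t y = Orb.mk G H K C t y ↔
      ∃ (h : H) (d : C), (((g, h), c * d) : (G × H) × C) • t = t ∧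
        (((h, l), d⁻¹) : (H × K) × C) • y = y := by
  rw [Orb.smul_mk, Orb.mk_eq_iff]
  refine exists_congr fun h => exists_congr fun d => ?_
  simp only [smul_smul, Prod.mk_mul_mk, one_mul, mul_one]
  rw [eq_comm, mul_comm d c]
  exact and_congr_right fun _ => eq_comm

/-- The case of the Mackey formula with a single double coset, since the stabilizer of `t` projects
onto `H`. -/
theorem orb_transitive {T Y : Type} [MulAction ((G × H) × C) T] [MulAction ((H × K) × C) Y]
    {t : T} {y : Y} (ht : ∀ t' : T, ∃ p : (G × H) × C, p • t = t')
    (hy : ∀ y' : Y, ∃ p : (H × K) × C, p • y = y')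
    (hH : ∀ h : H, ∃ (g : G) (c : C), (((g, h), c) : (G × H) × C) • t = t)
    (w : Orb G H K C T Y) : ∃ p : (G × K) × C, p • Orb.mk G H K C t y = w := by
  induction w using Orb.ind with | _ t' y' =>
  obtain ⟨⟨⟨g, h⟩, c⟩, rfl⟩ := ht t'
  obtain ⟨⟨⟨h', l⟩, c'⟩, rfl⟩ := hy y'
  -- The discrepancy of the `H`-coordinates is absorbed by an element of the stabilizer of `t` lying
  -- over it.
  obtain ⟨g₁, c₁, h₁⟩ := hH (h'⁻¹ * h)
  refine ⟨((g * g₁⁻¹, l), c * c' * c₁⁻¹), ?_⟩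
  rw [Orb.smul_mk, Orb.mk_eq_iff]
  refine ⟨h', c'⁻¹, ?_, ?_⟩
  · nth_rewrite 2 [← h₁]
    simp only [smul_smul, Prod.mk_mul_mk]
    congr 2
    ext
    · simp
    · simp
    · simp [mul_comm c]
  · simp [smul_smul]

variable {T : Type} [MulAction ((G × H) × C) T] {Y : Type} [MulAction ((H × G) × C) Y]

/-- By `hop` the stabilizer of `y` is opposite to that of `t`, so two elements of `G` are related as
soon as they share a partner in `H`; the element of `C` records the quotient of the two
`C`-components. -/
theorem orb_op_smul_mk_eq_iff {t : T} {y : Y}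
    (hop : ∀ g h c, (((h, g), c) : (H × G) × C) • y = y ↔ (((g, h), c⁻¹) : (G × H) × C) • t = t)
    (g g' : G) (c : C) :
    (((g, g'), c) : (G × G) × C) • Orb.mk G H G C t y = Orb.mk G H G C t y ↔
      ∃ (h : H) (d : C), (((g, h), c * d) : (G × H) × C) • t = t ∧
        (((g', h), d) : (G × H) × C) • t = t := by
  simp only [orb_smul_mk_eq_iff, hop, inv_inv]

theorem div_smul_eq {Γ X : Type} [Group Γ] [MulAction Γ X] {x : X} {p q : Γ} (hp : p • x = x)
    (hq : q • x = x) : (p * q⁻¹) • x = x :=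
  (stabilizer Γ x).mul_mem hp ((stabilizer Γ x).inv_mem hq)

/-- Dividing two elements over the same `h` cancels `h` and leaves `((g, 1), c)`. For `g = 1` this
gives freeness of `C` at the base point. -/
theorem orb_op_fixed_left {t : T} {y : Y}
    (hop : ∀ g h c, (((h, g), c) : (H × G) × C) • y = y ↔ (((g, h), c⁻¹) : (G × H) × C) • t = t)
    {g : G} {c : C}
    (h : (((g, 1), c) : (G × G) × C) • Orb.mk G H G C t y = Orb.mk G H G C t y) :
    (((g, 1), c) : (G × H) × C) • t = t := by
  obtain ⟨h, d, h1, h2⟩ := (orb_op_smul_mk_eq_iff hop g 1 c).1 h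
  simpa using div_smul_eq h1 h2

theorem orb_op_free {t : T} {y : Y} (hT : IsFibred (G × H) C T)
    (hop : ∀ g h c, (((h, g), c) : (H × G) × C) • y = y ↔ (((g, h), c⁻¹) : (G × H) × C) • t = t)
    (c : C) (h : ((1, c) : (G × G) × C) • Orb.mk G H G C t y = Orb.mk G H G C t y) : c = 1 :=
  hT c t (orb_op_fixed_left hop h)

/-- The base point of the composition of a transitive fibred set with its opposite. -/
def basePoint {t : T} {y : Y} (hT : IsFibred (G × H) C T)
    (hop : ∀ g h c, (((h, g), c) : (H × G) × C) • y = y ↔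
      (((g, h), c⁻¹) : (G × H) × C) • t = t) : CompSet G H G C T Y :=
  ⟨Orb.mk G H G C t y, orb_op_free hT hop⟩

theorem basePoint_smul_eq_iff {t : T} {y : Y} (hT : IsFibred (G × H) C T)
    (hop : ∀ g h c, (((h, g), c) : (H × G) × C) • y = y ↔ (((g, h), c⁻¹) : (G × H) × C) • t = t)
    (p : (G × G) × C) : p • basePoint hT hop = basePoint hT hop ↔
      p • Orb.mk G H G C t y = Orb.mk G H G C t y :=
  Subtype.ext_iff

theorem basePoint_transitive {t : T} {y : Y} (hT : IsFibred (G × H) C T)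
    (hop : ∀ g h c, (((h, g), c) : (H × G) × C) • y = y ↔ (((g, h), c⁻¹) : (G × H) × C) • t = t)
    (ht : ∀ t' : T, ∃ p : (G × H) × C, p • t = t')
    (hy : ∀ y' : Y, ∃ p : (H × G) × C, p • y = y')
    (hH : ∀ h : H, ∃ (g : G) (c : C), (((g, h), c) : (G × H) × C) • t = t)
    (w : CompSet G H G C T Y) : ∃ p : (G × G) × C, p • basePoint hT hop = w := by
  obtain ⟨p, hp⟩ := orb_transitive ht hy hH w.1
  exact ⟨p, Subtype.ext hp⟩

theorem basePoint_diag {t : T} {y : Y} (hT : IsFibred (G × H) C T)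
    (hop : ∀ g h c, (((h, g), c) : (H × G) × C) • y = y ↔ (((g, h), c⁻¹) : (G × H) × C) • t = t)
    (hG : ∀ g : G, ∃ (h : H) (c : C), (((g, h), c) : (G × H) × C) • t = t) (g : G) :
    (((g, g), 1) : (G × G) × C) • basePoint hT hop = basePoint hT hop := by
  rw [basePoint_smul_eq_iff, orb_op_smul_mk_eq_iff hop]
  obtain ⟨h, c, hc⟩ := hG g
  exact ⟨h, c, by rwa [one_mul], hc⟩

/-- The composition of a transitive fibred set with its opposite is idempotent if the projections
of its stabilizers are onto. -/
theorem compSet_op_idempotent {t : T} {y : Y} (hT : IsFibred (G × H) C T)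
    (hop : ∀ g h c, (((h, g), c) : (H × G) × C) • y = y ↔ (((g, h), c⁻¹) : (G × H) × C) • t = t)
    (ht : ∀ t' : T, ∃ p : (G × H) × C, p • t = t')
    (hy : ∀ y' : Y, ∃ p : (H × G) × C, p • y = y')
    (hH : ∀ h : H, ∃ (g : G) (c : C), (((g, h), c) : (G × H) × C) • t = t)
    (hG : ∀ g : G, ∃ (h : H) (c : C), (((g, h), c) : (G × H) × C) • t = t) :
    GSetIso ((G × G) × C) (CompSet G G G C (CompSet G H G C T Y) (CompSet G H G C T Y))
      (CompSet G H G C T Y) := by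
  have htr := basePoint_transitive hT hop ht hy hH
  have hd := basePoint_diag hT hop hG
  have hiso : GSetIso ((G × G) × C) (Orb G G G C (CompSet G H G C T Y) (CompSet G H G C T Y))
      (CompSet G H G C T Y) := by
    refine gsetIso_of_stabilizer_eq _ _ (orb_transitive htr htr fun g => ⟨g, 1, hd g⟩) htr ?_
    ext ⟨⟨g, g'⟩, c⟩
    rw [mem_stabilizer_iff, mem_stabilizer_iff, orb_smul_mk_eq_iff]
    constructor
    · rintro ⟨g₁, e, h1, h2⟩
      rw [basePoint_smul_eq_iff, orb_op_smul_mk_eq_iff hop] at h1 h2 ⊢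
      obtain ⟨h, d, h3, h4⟩ := h1
      obtain ⟨h', d', h5, h6⟩ := h2
      refine ⟨h', d', ?_, h6⟩
      -- The product of `(g, h)`, the inverse of `(g₁, h)` and `(g₁, h')` is `(g, h')`, with
      -- `C`-component `c * d'`.
      have := (stabilizer ((G × H) × C) t).mul_mem (div_smul_eq h3 h4) h5
      rw [mem_stabilizer_iff] at this
      convert this using 2
      ext <;> simp [mul_assoc]
    · intro h
      -- The diagonal element over `g'` serves as the second factor.
      exact ⟨g', 1, by rwa [mul_one], by simpa using hd g'⟩
  exact (FreePart.congr hiso).trans (FreePart.of_isFibred (FreePart.isFibred _))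

end Composition

/-! ### Base points of the transitive fibred sets -/

section TransitiveComposition

variable {G H C : Type} [Group G] [Group H] [CommGroup C]

theorem fibredCoset_smul_eq_iff {Γ : Type} [Group Γ] (D : Subgroup Γ) (δ : D →* C) (p : Γ × C) :
    p • (QuotientGroup.mk 1 : FibredCoset D δ) = QuotientGroup.mk 1 ↔ p ∈ twist D δ := by
  rw [← inv_mem_iff]
  refine QuotientGroup.eq.trans ?_
  simp

theorem fibredCoset_transitive {Γ : Type} [Group Γ] (D : Subgroup Γ) (δ : D →* C)
    (t : FibredCoset D δ) : ∃ p : Γ × C, p • (QuotientGroup.mk 1 : FibredCoset D δ) = t := by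
  obtain ⟨p, rfl⟩ := QuotientGroup.mk_surjective t
  exact ⟨p, congrArg QuotientGroup.mk (mul_one p)⟩

theorem fibredCoset_op (D : Subgroup (G × H)) (δ : D →* C) (g : G) (h : H) (c : C) :
    (((h, g), c) : (H × G) × C) •
        (QuotientGroup.mk 1 : FibredCoset (opSubgroup D) (opHom δ)) = QuotientGroup.mk 1 ↔
      (((g, h), c⁻¹) : (G × H) × C) • (QuotientGroup.mk 1 : FibredCoset D δ) =
        QuotientGroup.mk 1 := by
  rw [fibredCoset_smul_eq_iff, fibredCoset_smul_eq_iff]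
  refine exists_congr fun hgh => ?_
  change c = ((δ ⟨(g, h), hgh⟩)⁻¹)⁻¹ ↔ c⁻¹ = (δ ⟨(g, h), hgh⟩)⁻¹
  rw [inv_inv, inv_inj]

theorem fibredCoset_exists {D : Subgroup (G × H)} (δ : D →* C) {g : G} {h : H}
    (hgh : (g, h) ∈ D) : ∃ c : C, (((g, h), c) : (G × H) × C) •
      (QuotientGroup.mk 1 : FibredCoset D δ) = QuotientGroup.mk 1 :=
  ⟨(δ ⟨(g, h), hgh⟩)⁻¹, (fibredCoset_smul_eq_iff D δ _).2 ⟨hgh, rfl⟩⟩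

end TransitiveComposition

/-! ### The element `X ∘ X°` and its multiplicity form -/

section OpComposition

open MulAction TensorProduct

variable (R : Type u) [CommRing R] {G H C : Type} [Group G] [Group H] [CommGroup C]
  (D : Subgroup (G × H)) (δ : D →* C)

/-- The set `X ∘ X°`, where `X = C_δ(G × H)/D`. -/
abbrev OpCompSet : Type :=
  CompSet G H G C (FibredCoset D δ) (FibredCoset (opSubgroup D) (opHom δ))

/-- The base point of `X ∘ X°`. -/
def opCompBase : OpCompSet D δ :=
  basePoint (isFibred_fibredCoset D δ) (fibredCoset_op D δ)

variable {D} in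
theorem opCompBase_smul_diag (hG : ∀ g : G, ∃ h : H, (g, h) ∈ D) (g : G) :
    (((g, g), 1) : (G × G) × C) • opCompBase D δ = opCompBase D δ := by
  refine basePoint_diag _ _ (fun g => ?_) g
  obtain ⟨h, hh⟩ := hG g
  exact ⟨h, fibredCoset_exists δ hh⟩

-- Over `G × 1`, the stabilizer of the base point of `X ∘ X°` gives back elements of `D_δ`; this is
-- how the values of `δ` there enter the counting argument.
variable {D} in
theorem mem_of_smul_opCompBase {g : G} {c : C}
    (h : (((g, 1), c) : (G × G) × C) • opCompBase D δ = opCompBase D δ) :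
    ∃ hg : (g, 1) ∈ D, c = (δ ⟨(g, 1), hg⟩)⁻¹ :=
  (fibredCoset_smul_eq_iff D δ _).1
    (orb_op_fixed_left (fibredCoset_op D δ) ((basePoint_smul_eq_iff _ _ _).1 h))

variable [Finite G] [Finite H] [Finite C]

theorem compR_transElt_op :
    compR R G H G C (transElt R D δ) (transElt R (opSubgroup D) (opHom δ)) =
      1 ⊗ₜ ⟨bcls ((G × G) × C) (OpCompSet D δ), bcls_mem (FreePart.isFibred _)⟩ := by
  rw [transElt, transElt, compR_tmul, mul_one]
  congr 1
  exact Subtype.ext (compB_bcls G H G C _ _)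

variable {D}

theorem compR_transElt_op_idempotent (hG : ∀ g : G, ∃ h : H, (g, h) ∈ D)
    (hH : ∀ h : H, ∃ g : G, (g, h) ∈ D) :
    compR R G G G C (compR R G H G C (transElt R D δ) (transElt R (opSubgroup D) (opHom δ)))
        (compR R G H G C (transElt R D δ) (transElt R (opSubgroup D) (opHom δ))) =
      compR R G H G C (transElt R D δ) (transElt R (opSubgroup D) (opHom δ)) := by
  rw [compR_transElt_op, compR_tmul, mul_one]
  congr 1
  refine Subtype.ext ((compB_bcls G G G C _ _).trans (bcls_congr ?_))
  refine compSet_op_idempotent (isFibred_fibredCoset D δ) (fibredCoset_op D δ)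
    (fibredCoset_transitive _ _) (fibredCoset_transitive _ _) (fun h => ?_) fun g => ?_
  · obtain ⟨g, hg⟩ := hH h
    exact ⟨g, fibredCoset_exists δ hg⟩
  · obtain ⟨h, hh⟩ := hG g
    exact ⟨h, fibredCoset_exists δ hh⟩

/-- The set is a single orbit, so the coefficient is 1 in every ring of coefficients. -/
theorem multR_compR_transElt_op (hH : ∀ h : H, ∃ g : G, (g, h) ∈ D) :
    multR R (stabilizer ((G × G) × C) (opCompBase D δ))
      (compR R G H G C (transElt R D δ) (transElt R (opSubgroup D) (opHom δ))) = 1 := by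
  rw [compR_transElt_op, multR_tmul]
  dsimp only
  rw [multB_bcls, StabOrbits.card_eq_one (opCompBase D δ) rfl]
  · simp
  · refine basePoint_transitive _ _ (fibredCoset_transitive _ _) (fibredCoset_transitive _ _)
      fun h => ?_
    obtain ⟨g, hg⟩ := hH h
    exact ⟨g, fibredCoset_exists δ hg⟩

variable {R}

/-- Bilinearity reduces the claim to compositions of actual sets, where the coefficient counts
orbits with a point of stabilizer `S`. -/
theorem multR_eq_zero_of_mem_factorSubmodule {X : FibObj R C}
    (S : Subgroup ((X.carrier × X.carrier) × C))
    (hS : ∀ K : FibObj R C, Nat.card K.carrier < Nat.card X.carrier →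
      ∀ (T Y : Type) [MulAction ((X.carrier × K.carrier) × C) T]
        [MulAction ((K.carrier × X.carrier) × C) Y] (t : T) (y : Y),
        stabilizer ((X.carrier × X.carrier) × C)
          (Orb.mk X.carrier K.carrier X.carrier C t y) ≠ S)
    {f : X ⟶ X} (hf : f ∈ factorSubmodule X) : multR R S f = 0 := by
  induction hf using Submodule.span_induction with
  | zero => exact map_zero _
  | add x y _ _ hx hy => exact (map_add (multR R S) x y).trans (by rw [hx, hy, add_zero])
  | smul r x _ hx => exact (map_smul (multR R S) r x).trans (by rw [hx, smul_zero])
  | mem x hx =>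
    obtain ⟨K, a, b, hK, rfl⟩ := hx
    rw [comp_eq]
    induction a using TensorProduct.induction_on with
    | zero => rw [map_zero, LinearMap.zero_apply, map_zero]
    | add a a' h h' => rw [map_add, LinearMap.add_apply, map_add, h, h', add_zero]
    | tmul r a =>
    induction b using TensorProduct.induction_on with
    | zero => rw [map_zero, map_zero]
    | add b b' h h' => rw [map_add, map_add, h, h', add_zero]
    | tmul s b =>
    rw [compR_tmul, multR_tmul, compM_coe]
    suffices multB S (compB X.carrier K.carrier X.carrier C a.1 b.1) = 0 by rw [this, zero_smul]
    generalize a.1 = a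
    generalize b.1 = b
    induction a using burnside_induction with
    | hs a a' h h' => rw [map_sub, AddMonoidHom.sub_apply, map_sub, h, h', sub_zero]
    | h T =>
    induction b using burnside_induction with
    | hs b b' h h' => rw [map_sub, map_sub, h, h', sub_zero]
    | h Y =>
    rw [compB_bcls, multB_bcls, StabOrbits.card_eq_zero, Nat.cast_zero]
    rintro ⟨w, hw⟩ h
    induction w using Orb.ind with | _ t y =>
    -- Passing to the free part does not change the stabilizer of a point.
    refine hS K hK T Y t y (h ▸ ?_)
    ext p
    exact ⟨fun h => Subtype.ext h, fun h => congrArg Subtype.val h⟩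

end OpComposition

/-! ### The lower bound for the order of an intermediate group -/

section Counting

variable {G K C : Type} [Group G] [Group K] [CommGroup C]

/-- If a point of a `(G × K) × C`-set has stabilizer projecting onto `G`, meeting `G` in a subgroup
of `⟨z⟩`, where `z` is an involution and a commutator, and if `z` does not fix the point,
then `|G| ≤ |K|`. -/
theorem card_le_card_of_stabilizer [Finite K] {T : Type} [MulAction ((G × K) × C) T] {t : T}
    {x y z : G} (hxy : x * y * x⁻¹ * y⁻¹ = z) (hzz : z * z = 1)
    (hG : ∀ g : G, ∃ (h : K) (c : C), (((g, h), c) : (G × K) × C) • t = t)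
    (hz : ∀ (g : G) (c : C), (((g, 1), c) : (G × K) × C) • t = t → g = 1 ∨ g = z)
    (hz1 : ¬ (((z, 1), 1) : (G × K) × C) • t = t) : Nat.card G ≤ Nat.card K := by
  choose f c hf using hG
  -- Elements of `G` with a common partner in `K` differ by `1` or `z`.
  have hdiv : ∀ {g g' : G} {h : K} {d d' : C}, (((g, h), d) : (G × K) × C) • t = t →
      (((g', h), d') : (G × K) × C) • t = t → g⁻¹ * g' = 1 ∨ g⁻¹ * g' = z := by
    intro g g' h d d' h1 h2
    refine hz _ (d⁻¹ * d') ?_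
    have := (MulAction.stabilizer ((G × K) × C) t).mul_mem
      ((MulAction.stabilizer ((G × K) × C) t).inv_mem h1) h2
    simpa using this
  by_cases hc : ∃ d : C, (((z, 1), d) : (G × K) × C) • t = t
  · obtain ⟨d, hd⟩ := hc
    -- The commutator of the lifts of `x` and `y` lies over `z`, and its `C`-component cancels
    -- because `C` is abelian.
    have hcomm : (((z, f x * f y * (f x)⁻¹ * (f y)⁻¹), 1) : (G × K) × C) • t = t := by
      have h1 := div_smul_eq (div_smul_eq ((MulAction.stabilizer ((G × K) × C) t).mul_mem
        (hf x) (hf y)) (hf x)) (hf y)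
      have h2 : ((x, f x), c x) * ((y, f y), c y) * ((x, f x), c x)⁻¹ * ((y, f y), c y)⁻¹ =
          (((z, f x * f y * (f x)⁻¹ * (f y)⁻¹), 1) : (G × K) × C) := by
        rw [← hxy]
        ext
        · rfl
        · rfl
        · simp
      rwa [h2] at h1
    set κ := f x * f y * (f x)⁻¹ * (f y)⁻¹ with hκ
    have hκ1 : κ ≠ 1 := fun h => hz1 (h ▸ hcomm)
    -- Dividing by `((z, 1), d)` shows that multiplication by `κ` turns a partner of an element of
    -- `G` into another partner of it.
    have hκd : (((1, κ), d⁻¹) : (G × K) × C) • t = t := by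
      simpa using div_smul_eq hcomm hd
    let r : G → G := fun g => (QuotientGroup.mk g : G ⧸ Subgroup.zpowers z).out
    have hr : ∀ g, g = r g ∨ g = r g * z := fun g => by
      have h1 : (r g)⁻¹ * g ∈ Subgroup.zpowers z :=
        QuotientGroup.eq.1 (QuotientGroup.out_eq' (QuotientGroup.mk g))
      obtain ⟨n, hn⟩ := h1
      rcases Int.even_or_odd' n with ⟨m, rfl | rfl⟩
      · left
        simp only [zpow_mul, zpow_two, hzz, one_zpow] at hn
        exact (inv_mul_eq_one.1 hn.symm).symm
      · right
        simp only [zpow_add, zpow_mul, zpow_two, hzz, one_zpow, one_mul, zpow_one] at hn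
        rw [hn, mul_inv_cancel_left]
    have hrr : ∀ g g', (r g)⁻¹ * r g' = 1 ∨ (r g)⁻¹ * r g' = z → r g = r g' := fun g g' h => by
      have h1 : (r g)⁻¹ * r g' ∈ Subgroup.zpowers z := by
        rcases h with h | h <;> rw [h]
        · exact one_mem _
        · exact Subgroup.mem_zpowers z
      have h2 : (QuotientGroup.mk (r g) : G ⧸ Subgroup.zpowers z) = QuotientGroup.mk (r g') :=
        QuotientGroup.eq.2 h1
      have h3 : ∀ g, (QuotientGroup.mk (r g) : G ⧸ Subgroup.zpowers z) = QuotientGroup.mk g :=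
        fun g => QuotientGroup.out_eq' _
      rw [h3, h3] at h2
      exact congrArg Quotient.out h2
    classical
    -- The two elements of a coset of `⟨z⟩` get the two partners `f (r g)` and `f (r g) * κ` of its
    -- representative: `hdiv` separates the cosets and `κ ≠ 1` the elements of one coset.
    let F : G → K := fun g => f (r g) * if g = r g then 1 else κ
    have hF : ∀ g, ∃ e : C, (((r g, F g), e) : (G × K) × C) • t = t := fun g => by
      by_cases h : g = r g
      · refine ⟨c (r g), ?_⟩
        simp only [F, if_pos h, mul_one]
        exact hf (r g)
      · refine ⟨c (r g) * d⁻¹, ?_⟩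
        have h1 := (MulAction.stabilizer ((G × K) × C) t).mul_mem (hf (r g)) hκd
        simpa [F, if_neg h] using h1
    refine Nat.card_le_card_of_injective F fun g g' h => ?_
    obtain ⟨e, he⟩ := hF g
    obtain ⟨e', he'⟩ := hF g'
    have hgg : r g = r g' := hrr g g' (hdiv (h ▸ he) he')
    simp only [F, hgg] at h
    have h := mul_left_cancel h
    by_cases h1 : g = r g'
    · by_cases h2 : g' = r g'
      · exact h1.trans h2.symm
      · rw [if_pos h1, if_neg h2] at h
        exact absurd h.symm hκ1
    · by_cases h2 : g' = r g'
      · rw [if_neg h1, if_pos h2] at h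
        exact absurd h hκ1
      · rw [(hr g).resolve_left (hgg ▸ h1), (hr g').resolve_left h2, hgg]
  · push Not at hc
    -- Here nothing over `(z, 1)` fixes `t`, so elements with equal partners coincide.
    refine Nat.card_le_card_of_injective f fun g g' h => ?_
    have h1 := (MulAction.stabilizer ((G × K) × C) t).mul_mem
      ((MulAction.stabilizer ((G × K) × C) t).inv_mem (hf g)) (hf g')
    rw [h] at h1
    rcases hdiv (hf g) (h ▸ hf g') with h2 | h2
    · exact inv_mul_eq_one.1 h2
    · refine absurd ?_ (hc ((c g)⁻¹ * c g'))
      rw [← h2]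
      simpa using h1

end Counting

/-! ### The groups Q₈ and D₈ and the subgroup `D` -/

section Groups

/-- The exponent and the type (power of `x`, or power of `x` times `y`) of an element of `Q₈`. -/
def quaternionCoord : QuaternionGroup 2 → ZMod 4 × Bool
  | .a i => (i, false)
  | .xa i => (i, true)

/-- The exponent and the type of an element of `D₈`. -/
def dihedralCoord : DihedralGroup 4 → ZMod 4 × Bool
  | .r i => (i, false)
  | .sr i => (i, true)

/-- The exponent `e` with `δ(g, h) = c ^ e`. -/
def exampleExponent (p : QuaternionGroup 2 × DihedralGroup 4) : ZMod 4 :=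
  (quaternionCoord p.1).1 + (dihedralCoord p.2).1 + bif (quaternionCoord p.1).2 then 3 else 0

/-- Multiplying by a second factor of type `y` reverses the sign of the first exponents `i` and `j`,
which is harmless since `2 (i + j) = 0`; for two factors of that type, `y² = x²` contributes 2,
which equals `3 + 3` modulo 4. -/
theorem exampleExponent_mul {p q : QuaternionGroup 2 × DihedralGroup 4}
    (hp : (quaternionCoord p.1).2 = (dihedralCoord p.2).2 ∧
      2 * ((quaternionCoord p.1).1 + (dihedralCoord p.2).1) = 0)
    (hq : (quaternionCoord q.1).2 = (dihedralCoord q.2).2 ∧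
      2 * ((quaternionCoord q.1).1 + (dihedralCoord q.2).1) = 0) :
    exampleExponent (p * q) = exampleExponent p + exampleExponent q ∧
      (quaternionCoord (p * q).1).2 = (dihedralCoord (p * q).2).2 ∧
      2 * ((quaternionCoord (p * q).1).1 + (dihedralCoord (p * q).2).1) = 0 := by
  obtain ⟨i | i, j | j⟩ := p <;> obtain ⟨i' | i', j' | j'⟩ := q <;>
    simp only [quaternionCoord, dihedralCoord, Bool.false_eq_true, Bool.true_eq_false, false_and,
      true_and] at hp hq <;>
    revert hp hq <;> revert i j i' j' <;> decide

/-- The subgroup of `Q₈ × D₈` of the pairs with equal image in the four-group. -/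
def exampleSubgroup : Subgroup (QuaternionGroup 2 × DihedralGroup 4) where
  carrier := {p | (quaternionCoord p.1).2 = (dihedralCoord p.2).2 ∧
    2 * ((quaternionCoord p.1).1 + (dihedralCoord p.2).1) = 0}
  one_mem' := ⟨rfl, rfl⟩
  mul_mem' hp hq := (exampleExponent_mul hp hq).2
  inv_mem' {p} hp := by
    obtain ⟨i | i, j | j⟩ := p <;> revert hp <;> revert i j <;> decide

theorem exampleD_le : exampleD ≤ exampleSubgroup := by
  refine (Subgroup.closure_le _).2 ?_
  rintro p (rfl | rfl)
  · exact ⟨rfl, rfl⟩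
  · exact ⟨rfl, rfl⟩

theorem mem_exampleD_pow (i j : ℕ) :
    ((QuaternionGroup.a 1 ^ i * QuaternionGroup.xa 0 ^ j,
      DihedralGroup.r 1 ^ i * DihedralGroup.sr 0 ^ j) :
        QuaternionGroup 2 × DihedralGroup 4) ∈ exampleD :=
  exampleD.mul_mem (exampleD.pow_mem genXA.2 i) (exampleD.pow_mem genYB.2 j)

theorem exists_mem_exampleD_left (g : QuaternionGroup 2) : ∃ h, (g, h) ∈ exampleD := by
  have : ∀ g : QuaternionGroup 2, ∃ i j : Fin 4,
      QuaternionGroup.a 1 ^ (i : ℕ) * QuaternionGroup.xa 0 ^ (j : ℕ) = g := by decide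
  obtain ⟨i, j, rfl⟩ := this g
  exact ⟨_, mem_exampleD_pow i j⟩

theorem exists_mem_exampleD_right (h : DihedralGroup 4) : ∃ g, (g, h) ∈ exampleD := by
  have : ∀ h : DihedralGroup 4, ∃ i j : Fin 4,
      DihedralGroup.r 1 ^ (i : ℕ) * DihedralGroup.sr 0 ^ (j : ℕ) = h := by decide
  obtain ⟨i, j, rfl⟩ := this h
  exact ⟨_, mem_exampleD_pow i j⟩

theorem eq_of_mem_exampleD {g : QuaternionGroup 2} (hg : (g, 1) ∈ exampleD) :
    g = 1 ∨ g = QuaternionGroup.a 2 := by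
  have h1 : (quaternionCoord g).2 = false ∧ 2 * ((quaternionCoord g).1 + 0) = 0 := exampleD_le hg
  clear hg
  revert h1
  revert g
  decide

/-- As `y² = x²` but `b² = 1`, the value of `δ` at `(x², 1)` is the square of its value at `(y, b)`.
-/
theorem genYB_sq : ((genYB ^ 2 : exampleD) : QuaternionGroup 2 × DihedralGroup 4) =
    (QuaternionGroup.a 2, 1) := by
  change (QuaternionGroup.xa 0 ^ 2, DihedralGroup.sr 0 ^ 2) = _
  decide

/-- Q₈ has a single involution, while D₈ has several reflections. -/
theorem isEmpty_quaternionGroup_equiv_dihedralGroup :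
    IsEmpty (QuaternionGroup 2 ≃* DihedralGroup 4) := by
  refine ⟨fun φ => ?_⟩
  have h : ∀ d : DihedralGroup 4, d * d = 1 → d ≠ 1 → φ.symm d = QuaternionGroup.a 2 :=
    fun d hd hd1 => by
      have h1 : ∀ g : QuaternionGroup 2, g * g = 1 → g ≠ 1 → g = QuaternionGroup.a 2 := by decide
      refine h1 _ (by rw [← map_mul, hd, map_one]) fun h2 => hd1 ?_
      rw [← φ.apply_symm_apply d, h2, map_one]
  have h2 := (h (DihedralGroup.sr 0) (by decide) (by decide)).trans
    (h (DihedralGroup.sr 1) (by decide) (by decide)).symm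
  exact absurd (φ.symm.injective h2) (by decide)

end Groups

/-! ### The homomorphism `δ` and the idempotent `W` -/

section Example

variable {C : Type} [CommGroup C]

/-- The power of `c` with exponent in `ZMod 4`. -/
theorem pow_zmod_val_add {c : C} (hc : c ^ 4 = 1) (a b : ZMod 4) :
    c ^ (a + b).val = c ^ a.val * c ^ b.val := by
  rw [ZMod.val_add, ← pow_add, ← Nat.mod_add_div (a.val + b.val) 4, pow_add, pow_mul, hc, one_pow,
    mul_one, Nat.mod_add_div]

theorem exists_exampleHom {c : C} (hc : c ^ 4 = 1) :
    ∃ δ : exampleD →* C, δ genXA = c ^ 2 ∧ δ genYB = c⁻¹ := by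
  refine ⟨MonoidHom.mk' (fun p => c ^ (exampleExponent p.1).val) fun p q => ?_, ?_, ?_⟩
  · rw [← pow_zmod_val_add hc]
    congr 2
    exact (exampleExponent_mul (exampleD_le p.2) (exampleD_le q.2)).1
  · change c ^ (2 : ℕ) = c ^ 2
    rfl
  -- The exponent of `(y, b)` is 3, which represents -1 modulo 4.
  · change c ^ (3 : ℕ) = c⁻¹
    rw [eq_inv_iff_mul_eq_one, ← pow_succ, hc]

theorem exampleHom_ext {δ δ' : exampleD →* C} (h1 : δ genXA = δ' genXA)
    (h2 : δ genYB = δ' genYB) : δ = δ' := by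
  ext ⟨p, hp⟩
  induction hp using Subgroup.closure_induction with
  | mem p hp =>
    rcases hp with rfl | rfl
    · exact h1
    · exact h2
  | one => exact (map_one δ).trans (map_one δ').symm
  | mul p q hp hq h h' =>
    exact (map_mul δ ⟨p, hp⟩ ⟨q, hq⟩).trans
      ((congrArg₂ (· * ·) h h').trans (map_mul δ' ⟨p, hp⟩ ⟨q, hq⟩).symm)
  | inv p hp h =>
    exact (map_inv δ ⟨p, hp⟩).trans ((congrArg (·⁻¹) h).trans (map_inv δ' ⟨p, hp⟩).symm)

/-- Equality would transfer to the stabilizer of `t` the hypotheses of `card_le_card_of_stabilizer`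
with `z = x²`: the diagonal gives surjectivity onto Q₈, and `δ(x², 1) ≠ 1` excludes `((z, 1), 1)`.
-/
theorem stabilizer_orb_ne {δ : exampleD →* C} (hδ : δ genYB ^ 2 ≠ 1) {K : Type} [Group K]
    [Finite K] (hK : Nat.card K < Nat.card (QuaternionGroup 2)) {T Y : Type}
    [MulAction ((QuaternionGroup 2 × K) × C) T] [MulAction ((K × QuaternionGroup 2) × C) Y]
    (t : T) (y : Y) :
    MulAction.stabilizer ((QuaternionGroup 2 × QuaternionGroup 2) × C)
        (Orb.mk (QuaternionGroup 2) K (QuaternionGroup 2) C t y) ≠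
      MulAction.stabilizer _ (opCompBase exampleD δ) := by
  intro hty
  have hxy : QuaternionGroup.a 1 * QuaternionGroup.xa 0 * (QuaternionGroup.a 1)⁻¹ *
      (QuaternionGroup.xa 0)⁻¹ = (QuaternionGroup.a 2 : QuaternionGroup 2) := by decide
  have hzz : QuaternionGroup.a 2 * QuaternionGroup.a 2 = (1 : QuaternionGroup 2) := by decide
  refine hK.not_ge (card_le_card_of_stabilizer (C := C) (t := t) hxy hzz ?_ ?_ ?_)
  · intro g
    have h2 : (((g, g), 1) : (QuaternionGroup 2 × QuaternionGroup 2) × C) •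
        Orb.mk (QuaternionGroup 2) K (QuaternionGroup 2) C t y =
          Orb.mk (QuaternionGroup 2) K (QuaternionGroup 2) C t y := by
      have h3 := opCompBase_smul_diag δ exists_mem_exampleD_left g
      rw [← MulAction.mem_stabilizer_iff, ← hty] at h3
      exact h3
    obtain ⟨h, d, h3, -⟩ := (orb_smul_mk_eq_iff t y g g 1).1 h2
    exact ⟨h, _, h3⟩
  all_goals
    have hfix : ∀ (g : QuaternionGroup 2) (c : C),
        (((g, 1), c) : (QuaternionGroup 2 × K) × C) • t = t →
        ∃ hg : (g, 1) ∈ exampleD, c = (δ ⟨(g, 1), hg⟩)⁻¹ := fun g c h => by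
      refine mem_of_smul_opCompBase δ ?_
      rw [← MulAction.mem_stabilizer_iff, ← hty]
      -- An element over `(g, 1)` fixing `t` also fixes `[t, y]`, since the identity fixes `y`.
      refine (orb_smul_mk_eq_iff t y g 1 c).2 ⟨1, 1, by rwa [mul_one], ?_⟩
      rw [inv_one]
      exact one_smul _ y
  · exact fun g c h => eq_of_mem_exampleD (hfix g c h).1
  · intro h
    obtain ⟨hg, h2⟩ := hfix _ _ h
    rw [← map_pow, show genYB ^ 2 = ⟨(QuaternionGroup.a 2, 1), hg⟩ from Subtype.ext genYB_sq] at hδ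
    exact hδ (inv_eq_one.1 h2.symm)

variable (k : Type u) [Field k] [Finite C]

theorem exampleW_idempotent (δ : exampleD →* C) : IsIdempotentElem (exampleW k δ) :=
  compR_transElt_op_idempotent k δ exists_mem_exampleD_left exists_mem_exampleD_right

/-- The multiplicity form at the stabilizer of the base point is 1 on `W` and 0 on `I(Q₈)`. -/
theorem hatMk_exampleW_ne_zero {δ : exampleD →* C} (hδ : δ genYB ^ 2 ≠ 1) :
    Hat.mk (exampleW k δ) ≠ 0 := by
  rw [Ne, hatMk_eq_zero_iff]
  intro hW
  have h1 := multR_compR_transElt_op k δ exists_mem_exampleD_right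
  have h0 := multR_eq_zero_of_mem_factorSubmodule
    (MulAction.stabilizer _ (opCompBase exampleD δ))
    (fun K hK T Y _ _ t y => stabilizer_orb_ne hδ hK t y) hW
  exact one_ne_zero (h1.symm.trans h0)

end Example

end

theorem mainTheorem1 (k : Type*) [Field k] (C : Type) [CommGroup C] [Finite C] (c : C)
    (hc : orderOf c = 4) (hgen : ∀ z : C, z ∈ Subgroup.zpowers c) :
    (∃! δ : exampleD →* C, δ genXA = c ^ 2 ∧ δ genYB = c⁻¹) ∧
    (∀ δ : exampleD →* C, δ genXA = c ^ 2 → δ genYB = c⁻¹ →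
      IsIdempotentElem (exampleW k δ) ∧ Hat.mk (exampleW k δ) ≠ 0) ∧
    IsEmpty (QuaternionGroup 2 ≃* DihedralGroup 4) ∧
    (∃ S : SimpleFunctor k C, S.IsMinimal (FibObj.of k C (QuaternionGroup 2)) ∧
      S.IsMinimal (FibObj.of k C (DihedralGroup 4))) ∧
    ¬ Parametrization k C := by
  have hc4 : c ^ 4 = 1 := hc ▸ pow_orderOf_eq_one c
  -- This is the value `δ(x², 1) = δ(y, b)²`, nontrivial because `c` has order 4.
  have hc2 : c⁻¹ ^ 2 ≠ 1 := by
    rw [inv_pow, Ne, inv_eq_one]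
    exact pow_ne_one_of_lt_orderOf two_ne_zero (by omega)
  obtain ⟨δ, hδ1, hδ2⟩ := exists_exampleHom hc4
  have hcard : Nat.card (DihedralGroup 4) = Nat.card (QuaternionGroup 2) := by
    rw [DihedralGroup.nat_card, Nat.card_eq_fintype_card, QuaternionGroup.card]
  obtain ⟨S, hS1, hS2, hS⟩ := exists_simpleFunctor (k := k) (X := FibObj.of k C (QuaternionGroup 2))
    (Y := FibObj.of k C (DihedralGroup 4)) hcard (exampleXop k δ) (exampleX k δ)
    (exampleW_idempotent k δ) (hatMk_exampleW_ne_zero k (hδ2 ▸ hc2))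
  exact ⟨⟨δ, ⟨hδ1, hδ2⟩, fun δ' h => exampleHom_ext (h.1.trans hδ1.symm) (h.2.trans hδ2.symm)⟩,
    fun δ' _ h => ⟨exampleW_idempotent k δ', hatMk_exampleW_ne_zero k (h ▸ hc2)⟩,
    isEmpty_quaternionGroup_equiv_dihedralGroup, ⟨S, hS1, hS2⟩,
    not_parametrization hS1 hS2 hS isEmpty_quaternionGroup_equiv_dihedralGroup⟩
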